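/- Let $p$ be a prime and let $\xi$ be a $\mathbb{Z}$-valued random variable with $0<\mathbb{P}(p\mid\xi)<1$. For each $n\ge 1$ let $L_n$ be a random lower triangular $n\times n$ matrix whose entries on and below the diagonal are i.i.d. copies of $\xi$. Then the limit $$\chi_0=\lim_{n\to\infty}\mathbb{E}\,\bigl|\{v\in\mathbb{F}_p^n : v_1\neq 0,\ L_nv=0\}\bigr|$$ exists and $0<\chi_0<\infty$. Moreover, for every integer $\ell\ge 0$ and every finite abelian group $G$ with $|G|=p^\ell$, $$\lim_{n\to\infty} n^{-\ell}\,\mathbb{E}\,\bigl|\{v\in G^n : L_nv=0\}\bigr|=\frac{\chi_0^{\ell}\,\mathrm{MC}(G)}{\ell!},$$ where $\mathrm{MC}(G)$ is the number of maximal chains of subgroups of $G$, that is, of chains $\{0\}=H_0\subsetneq H_1\subsetneq\cdots\subsetneq H_\ell=G$. -/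

import Mathlib

open MeasureTheory ProbabilityTheory Filter Topology

/-- The solutions `v ∈ G^n` of `A v = 0`, for an integer matrix `A` acting on column vectors with
entries in an abelian group `G`. -/
def kernelVectors {n : ℕ} (A : Matrix (Fin n) (Fin n) ℤ) (G : Type*) [AddCommGroup G] :
    Set (Fin n → G) :=
  {v | ∀ i, ∑ j, A i j • v j = 0}

/-- `L` is a random lower triangular `n × n` matrix on the probability space `(Ω, P)` whose entries
on and below the diagonal are i.i.d. copies of the integer random variable `ξ` on `(Ω₀, P₀)`. -/
structure IsIIDLowerTriangular {Ω₀ : Type*} [MeasurableSpace Ω₀] (P₀ : Measure Ω₀) (ξ : Ω₀ → ℤ)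
    {Ω : Type*} [MeasurableSpace Ω] (P : Measure Ω) {n : ℕ}
    (L : Ω → Matrix (Fin n) (Fin n) ℤ) : Prop where
  measurable_entry : ∀ i j, Measurable (fun ω => L ω i j)
  eq_zero_of_lt : ∀ ω i j, i < j → L ω i j = 0
  identDistrib : ∀ i j, j ≤ i → IdentDistrib (fun ω => L ω i j) ξ P P₀
  iIndepFun_entry :
    iIndepFun (fun (e : {e : Fin n × Fin n // e.2 ≤ e.1}) ω => L ω e.1.1 e.1.2) P

/-- The expected number of solutions `v ∈ G^n` of `L v = 0`, for `L` a random `n × n` matrix. -/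
noncomputable def expectedKernelCard {Ω : Type*} [MeasurableSpace Ω] (P : Measure Ω) {n : ℕ}
    (L : Ω → Matrix (Fin n) (Fin n) ℤ) (G : Type*) [AddCommGroup G] : ℝ :=
  ∫ ω, ((kernelVectors (L ω) G).ncard : ℝ) ∂P

/-- The expected number of solutions `v ∈ 𝔽_p^n` of `L v = 0` whose first coordinate is nonzero
(there is no such `v` for `n = 0`). -/
noncomputable def expectedKernelCardFirstNeZero (p : ℕ) {Ω : Type*} [MeasurableSpace Ω]
    (P : Measure Ω) {n : ℕ} (L : Ω → Matrix (Fin n) (Fin n) ℤ) : ℝ :=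
  ∫ ω, (({v : Fin n → ZMod p | (∃ h : 0 < n, v ⟨0, h⟩ ≠ 0) ∧
    v ∈ kernelVectors (L ω) (ZMod p)}.ncard : ℕ) : ℝ) ∂P

/-- The number of chains of subgroups `{0} = H_0 ⊊ H_1 ⊊ ⋯ ⊊ H_ℓ = G` of length `ℓ`. For an abelian
group of order `p ^ ℓ` these are exactly the maximal chains of subgroups of `G`. -/
noncomputable def maximalChainCount (G : Type*) [AddCommGroup G] (ℓ : ℕ) : ℕ :=
  {H : Fin (ℓ + 1) → AddSubgroup G | H 0 = ⊥ ∧ H (Fin.last ℓ) = ⊤ ∧ StrictMono H}.ncard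

namespace TriangularKernel

open scoped Classical

/-! Build `v` one coordinate at a time. By triangularity row `i` sees only `v_0, …, v_i`, so the
probability that `L v = 0` is a product over the rows (`measureReal_matrix_eq`), and the expected
kernel size is the `n`-th iterate of a positive operator `step ⊤` on histories, applied to `1`
(`expectedKernelCard_eq`). Histories are sorted by the subgroup `H` they generate, which can only
grow.

While a history generates `H` and its random combination is nearly uniform on `H`, the `|H|` choices
of a next entry in `H` each carry weight about `1/|H|`, so total weight is nearly conserved. The
distance from uniform is controlled through characters by `mixErr`. Its exponential decay, uniform
over all histories generating `H`, is the main difficulty (`Contracts.exists_decay`). The threat is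
a run of later entries trapped in a proper subgroup `K`. Every row then forces the contribution of
the older entries into `K`, which costs a constant factor per row, because an inhomogeneous system
has at most as many solutions as the homogeneous one (`TranslateBound`). What is left is the
expected kernel size for `K`, which is only polynomial by induction on the subgroup.

Hence weight grows only through jumps `H' < H`. If `H'` has index `p` and the history in `H'` is
well mixed, then modulo `H'` a fresh problem over `ZMod p` starts with a nonzero coordinate, so the
jump and all that follows contribute asymptotically `χ₀` (`Contracts.exists_abs_jump_sub_lim_le`).
Summing over the time of the last jump (`step_top_pow_genInd_eq`) and averaging (`tendsto_sum_conv`)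
yields a factor `χ₀ n / (l + 1)` for the `(l + 1)`-st link of a chain. Chains with `ℓ` links
therefore give `χ₀^ℓ n^ℓ / ℓ!`, and shorter chains are of lower order. -/

/-- A probability law on the integers with finite support, indexed by a finite type. -/
structure CoeffLaw (ι : Type) [Fintype ι] where
  weight : ι → ℝ
  coeff : ι → ℤ
  weight_nonneg : ∀ a, 0 ≤ weight a
  sum_weight : ∑ a, weight a = 1

/-! ### Laws of random integer combinations, and Fourier inversion. -/

namespace CoeffLaw

variable {ι : Type} [Fintype ι] (μ : CoeffLaw ι)

/-- `μ.sumLaw u g` is the probability that `∑ ξ_j • u_j = g` for independent `ξ_j` of law `μ`. -/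
noncomputable def sumLaw {G : Type*} [AddCommGroup G] : List G → G → ℝ
  | [], g => if g = 0 then 1 else 0
  | x :: u, g => ∑ a, μ.weight a * sumLaw u (g - μ.coeff a • x)

/-- The characteristic function `E ψ(ξ • x)`. -/
noncomputable def charMean {G : Type*} [AddCommGroup G] (ψ : AddChar G ℂ) (x : G) : ℂ :=
  ∑ a, (μ.weight a : ℂ) * ψ (μ.coeff a • x)

section General

variable {G : Type*} [AddCommGroup G]

lemma sumLaw_nil (g : G) : μ.sumLaw [] g = if g = 0 then 1 else 0 := rfl

lemma sumLaw_cons (x : G) (u : List G) (g : G) :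
    μ.sumLaw (x :: u) g = ∑ a, μ.weight a * μ.sumLaw u (g - μ.coeff a • x) := rfl

lemma sumLaw_nonneg (u : List G) (g : G) : 0 ≤ μ.sumLaw u g := by
  induction u generalizing g with
  | nil => rw [sumLaw_nil]; split_ifs <;> norm_num
  | cons x u ih =>
    rw [sumLaw_cons]
    exact Finset.sum_nonneg fun a _ => mul_nonneg (μ.weight_nonneg a) (ih _)

lemma sumLaw_le_one (u : List G) (g : G) : μ.sumLaw u g ≤ 1 := by
  induction u generalizing g with
  | nil => rw [sumLaw_nil]; split_ifs <;> norm_num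
  | cons x u ih =>
    rw [sumLaw_cons, ← μ.sum_weight]
    exact Finset.sum_le_sum fun a _ => mul_le_of_le_one_right (μ.weight_nonneg a) (ih _)

lemma sumLaw_eq_zero_of_notMem (K : AddSubgroup G) (u : List G) (hu : ∀ x ∈ u, x ∈ K) (g : G)
    (hg : g ∉ K) : μ.sumLaw u g = 0 := by
  induction u generalizing g with
  | nil => rw [sumLaw_nil, if_neg]; rintro rfl; exact hg K.zero_mem
  | cons x u ih =>
    rw [sumLaw_cons]
    refine Finset.sum_eq_zero fun a _ => ?_
    rw [ih (fun y hy => hu y (List.mem_cons_of_mem _ hy)), mul_zero]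
    intro h
    exact hg (by simpa using K.add_mem h (K.zsmul_mem (hu x List.mem_cons_self) (μ.coeff a)))

lemma sumLaw_eq_one_of_forall_eq_zero (u : List G) (hu : ∀ x ∈ u, x = 0) : μ.sumLaw u 0 = 1 := by
  induction u with
  | nil => simp [sumLaw_nil]
  | cons x u ih =>
    rw [sumLaw_cons, hu x List.mem_cons_self]
    simp [ih (fun y hy => hu y (List.mem_cons_of_mem _ hy)), μ.sum_weight]

lemma pow_length_le_sumLaw (a : ι) (u : List G) (hu : ∀ x ∈ u, μ.coeff a • x = 0) :
    μ.weight a ^ u.length ≤ μ.sumLaw u 0 := by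
  induction u with
  | nil => simp [sumLaw_nil]
  | cons x u ih =>
    rw [sumLaw_cons, List.length_cons, pow_succ']
    refine le_trans ?_ (Finset.single_le_sum (f := fun a => μ.weight a * μ.sumLaw u
      (0 - μ.coeff a • x)) (fun b _ => mul_nonneg (μ.weight_nonneg b) (μ.sumLaw_nonneg _ _))
      (Finset.mem_univ a))
    have h := hu x List.mem_cons_self
    simp only [h, sub_zero]
    exact mul_le_mul_of_nonneg_left (ih fun y hy => hu y (List.mem_cons_of_mem _ hy))
      (μ.weight_nonneg a)

variable [Fintype G]

lemma sum_sumLaw (u : List G) : ∑ g, μ.sumLaw u g = 1 := by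
  induction u with
  | nil => simp [sumLaw_nil]
  | cons x u ih =>
    simp_rw [sumLaw_cons]
    rw [Finset.sum_comm, ← μ.sum_weight]
    refine Finset.sum_congr rfl fun a _ => ?_
    have h := Equiv.sum_comp (Equiv.subRight (μ.coeff a • x)) (μ.sumLaw u)
    simp only [Equiv.subRight_apply] at h
    rw [← Finset.mul_sum, h, ih, mul_one]

lemma sumLaw_append (z u : List G) (g : G) :
    μ.sumLaw (z ++ u) g = ∑ h, μ.sumLaw z h * μ.sumLaw u (g - h) := by
  induction z generalizing g with
  | nil => simp [sumLaw_nil]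
  | cons x z ih =>
    simp_rw [List.cons_append, sumLaw_cons, ih, Finset.mul_sum, Finset.sum_mul]
    rw [Finset.sum_comm]
    conv_lhs => rw [Finset.sum_comm]
    conv_rhs => rw [Finset.sum_comm]
    refine Finset.sum_congr rfl fun a _ => ?_
    rw [← Equiv.sum_comp (Equiv.subRight (μ.coeff a • x))]
    refine Finset.sum_congr rfl fun h _ => ?_
    simp only [Equiv.subRight_apply]
    rw [mul_assoc]
    congr 3
    abel

lemma sumLaw_map {G' : Type*} [AddCommGroup G'] (f : G →+ G') (u : List G) (b : G') :
    μ.sumLaw (u.map f) b = ∑ a with f a = b, μ.sumLaw u a := by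
  induction u generalizing b with
  | nil =>
    simp only [List.map_nil, sumLaw_nil, Finset.sum_ite_eq', Finset.mem_filter, Finset.mem_univ,
      true_and, map_zero, eq_comm]
  | cons x u ih =>
    simp_rw [List.map_cons, sumLaw_cons, ih]
    rw [Finset.sum_comm]
    refine Finset.sum_congr rfl fun a _ => ?_
    rw [← Finset.mul_sum]
    congr 1
    refine Finset.sum_equiv (Equiv.addRight (μ.coeff a • x)) ?_ ?_
    · intro i; simp [eq_sub_iff_add_eq]
    · intro i _; simp

lemma sum_sumLaw_mul_char (ψ : AddChar G ℂ) (u : List G) :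
    ∑ g, (μ.sumLaw u g : ℂ) * ψ g = (u.map (μ.charMean ψ)).prod := by
  induction u with
  | nil =>
    rw [Finset.sum_eq_single 0] <;> simp +contextual [sumLaw_nil]
  | cons x u ih =>
    rw [List.map_cons, List.prod_cons, ← ih, charMean, Finset.sum_mul]
    simp_rw [sumLaw_cons, Complex.ofReal_sum, Finset.sum_mul]
    rw [Finset.sum_comm]
    refine Finset.sum_congr rfl fun a _ => ?_
    rw [← Equiv.sum_comp (Equiv.addRight (μ.coeff a • x)), Finset.mul_sum]
    refine Finset.sum_congr rfl fun g _ => ?_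
    simp only [Equiv.coe_addRight, add_sub_cancel_right, AddChar.map_add_eq_mul]
    push_cast
    ring

/-- Fourier inversion: the transform of a convolution is a product of one-step characteristic
functions, and orthogonality of characters recovers the law. -/
lemma sumLaw_eq_sum_char (u : List G) (g : G) :
    (μ.sumLaw u g : ℂ) =
      (Fintype.card G : ℂ)⁻¹ * ∑ ψ : AddChar G ℂ, ψ (-g) * (u.map (μ.charMean ψ)).prod := by
  have hG : (Fintype.card G : ℂ) ≠ 0 := Nat.cast_ne_zero.2 Fintype.card_ne_zero
  rw [eq_inv_mul_iff_mul_eq₀ hG]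
  simp_rw [← sum_sumLaw_mul_char, Finset.mul_sum]
  rw [Finset.sum_comm]
  have : ∀ h : G, ∑ ψ : AddChar G ℂ, ψ (-g) * ((μ.sumLaw u h : ℂ) * ψ h) =
      (μ.sumLaw u h : ℂ) * (if h = g then (Fintype.card G : ℂ) else 0) := by
    intro h
    have h1 := AddChar.sum_apply_eq_ite (h - g)
    simp only [sub_eq_zero] at h1
    rw [← h1, Finset.mul_sum]
    refine Finset.sum_congr rfl fun ψ _ => ?_
    rw [sub_eq_neg_add, AddChar.map_add_eq_mul]
    ring
  simp_rw [this]
  simp [mul_comm]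

end General

/-! ### Contraction of characteristic functions -/

/-- All characteristic functions of `μ` on `G` are bounded by `θ < 1` off the kernel. -/
structure Contracts (G : Type*) [AddCommGroup G] (θ : ℝ) : Prop where
  pos : 0 < θ
  lt_one : θ < 1
  norm_charMean_le : ∀ (ψ : AddChar G ℂ) (x : G), ψ x ≠ 1 → ‖μ.charMean ψ x‖ ≤ θ

/-- `θ` to the number of entries of `u` off the kernel of `ψ`. -/
noncomputable def charErr {G : Type*} [AddCommGroup G] (θ : ℝ) (ψ : AddChar G ℂ) (u : List G) : ℝ :=
  (u.map fun x => if ψ x = 1 then 1 else θ).prod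

/-- The characters of `G` that are not trivial on `H`. -/
noncomputable def nontrivChars {G : Type*} [AddCommGroup G] [Fintype G] (H : AddSubgroup G) :
    Finset (AddChar G ℂ) :=
  {ψ | ∃ x ∈ H, ψ x ≠ 1}

/-- A bound for the distance of the law of `∑ ξ_j • u_j` from the uniform distribution on `H`. -/
noncomputable def mixErr {G : Type*} [AddCommGroup G] [Fintype G] (θ : ℝ) (H : AddSubgroup G)
    (u : List G) : ℝ :=
  ∑ ψ ∈ nontrivChars H, charErr θ ψ u

section

variable {G : Type*} [AddCommGroup G] {θ : ℝ}

lemma charErr_nil (ψ : AddChar G ℂ) : charErr θ ψ [] = 1 := by simp [charErr]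

lemma charErr_cons (ψ : AddChar G ℂ) (x : G) (u : List G) :
    charErr θ ψ (x :: u) = (if ψ x = 1 then 1 else θ) * charErr θ ψ u := by simp [charErr]

lemma charErr_pos (h0 : 0 < θ) (ψ : AddChar G ℂ) (u : List G) : 0 < charErr θ ψ u := by
  induction u with
  | nil => simp [charErr_nil]
  | cons x u ih => rw [charErr_cons]; split_ifs <;> positivity

lemma charErr_cons_le (h0 : 0 < θ) (h1 : θ < 1) (ψ : AddChar G ℂ) (x : G) (u : List G) :
    charErr θ ψ (x :: u) ≤ charErr θ ψ u := by
  rw [charErr_cons]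
  refine mul_le_of_le_one_left (charErr_pos h0 ψ u).le ?_
  split_ifs <;> linarith

lemma charErr_le_one (h0 : 0 < θ) (h1 : θ < 1) (ψ : AddChar G ℂ) (u : List G) :
    charErr θ ψ u ≤ 1 := by
  induction u with
  | nil => simp [charErr_nil]
  | cons x u ih => exact (charErr_cons_le h0 h1 ψ x u).trans ih

lemma charErr_le (h0 : 0 < θ) (h1 : θ < 1) (ψ : AddChar G ℂ) (u : List G)
    (hu : ∃ x ∈ u, ψ x ≠ 1) : charErr θ ψ u ≤ θ := by
  induction u with
  | nil => simp at hu
  | cons x u ih =>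
    by_cases hx : ψ x = 1
    · refine (charErr_cons_le h0 h1 ψ x u).trans (ih ?_)
      obtain ⟨y, hy, hy1⟩ := hu
      rcases List.mem_cons.1 hy with rfl | h
      · exact absurd hx hy1
      · exact ⟨y, h, hy1⟩
    · rw [charErr_cons, if_neg hx]
      exact mul_le_of_le_one_right h0.le (charErr_le_one h0 h1 ψ u)

variable [Fintype G]

lemma mixErr_nonneg (h0 : 0 < θ) (H : AddSubgroup G) (u : List G) : 0 ≤ mixErr θ H u :=
  Finset.sum_nonneg fun ψ _ => (charErr_pos h0 ψ u).le

lemma mixErr_cons_le (h0 : 0 < θ) (h1 : θ < 1) (H : AddSubgroup G) (x : G) (u : List G) :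
    mixErr θ H (x :: u) ≤ mixErr θ H u :=
  Finset.sum_le_sum fun ψ _ => charErr_cons_le h0 h1 ψ x u

lemma mixErr_bot (u : List G) : mixErr θ (⊥ : AddSubgroup G) u = 0 := by
  simp [mixErr, nontrivChars]

variable {μ}

namespace Contracts

variable (hθ : μ.Contracts G θ)
include hθ

lemma norm_charMean_le_ite (ψ : AddChar G ℂ) (x : G) :
    ‖μ.charMean ψ x‖ ≤ if ψ x = 1 then 1 else θ := by
  split_ifs with h
  · refine (norm_sum_le _ _).trans ?_
    rw [← μ.sum_weight]
    refine Finset.sum_le_sum fun a _ => ?_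
    rw [norm_mul, AddChar.norm_apply, mul_one, Complex.norm_real, Real.norm_of_nonneg
      (μ.weight_nonneg a)]
  · exact hθ.norm_charMean_le ψ x h

lemma norm_prod_le (ψ : AddChar G ℂ) (u : List G) :
    ‖(u.map (μ.charMean ψ)).prod‖ ≤ charErr θ ψ u := by
  induction u with
  | nil => simp [charErr_nil]
  | cons x u ih =>
    rw [List.map_cons, List.prod_cons, norm_mul, charErr_cons]
    exact mul_le_mul (hθ.norm_charMean_le_ite ψ x) ih (norm_nonneg _)
      (by split_ifs <;> linarith [hθ.pos])

omit hθ in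
-- Double counting of `∑ ψ h` over `h ∈ H` and all `ψ`: summing over `ψ` first leaves only `h = 0`,
-- summing over `h` first leaves only the characters trivial on `H`.
lemma card_trivial_chars (H : AddSubgroup G) :
    (Finset.card (nontrivChars H)ᶜ : ℂ) * Nat.card H = Fintype.card G := by
  have h1 : ∑ h : H, ∑ ψ : AddChar G ℂ, ψ (h : G) = Fintype.card G := by
    simp_rw [AddChar.sum_apply_eq_ite]
    simp
  rw [Finset.sum_comm] at h1
  rw [← h1, Nat.card_eq_fintype_card, Finset.card_eq_sum_ones, Nat.cast_sum, Finset.sum_mul,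
    ← Finset.sum_add_sum_compl (nontrivChars H) (fun ψ => ∑ h : H, ψ (h : G)),
    Finset.sum_eq_zero (s := nontrivChars H), zero_add]
  · refine Finset.sum_congr rfl fun ψ hψ => ?_
    simp only [nontrivChars, Finset.compl_filter, Finset.mem_filter, Finset.mem_univ, true_and,
      not_exists, not_and, not_not] at hψ
    rw [Finset.sum_congr rfl (fun (h : H) _ => hψ h h.2)]
    simp
  · intro ψ hψ
    simp only [nontrivChars, Finset.mem_filter, Finset.mem_univ, true_and] at hψ
    have := AddChar.sum_eq_ite (ψ.compAddMonoidHom H.subtype)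
    rw [if_neg] at this
    · simpa using this
    · intro h
      obtain ⟨x, hx, hx1⟩ := hψ
      exact hx1 (by simpa using DFunLike.congr_fun h ⟨x, hx⟩)

/-- In the inversion formula the characters trivial on `H` contribute exactly `1/|H|`; each of the
others is bounded by its `charErr`. -/
lemma abs_sumLaw_sub_le (H : AddSubgroup G) (u : List G) (hu : ∀ x ∈ u, x ∈ H) (h : G)
    (hh : h ∈ H) : |μ.sumLaw u h - (Nat.card H : ℝ)⁻¹| ≤ mixErr θ H u := by
  have hG : (Fintype.card G : ℂ) ≠ 0 := Nat.cast_ne_zero.2 Fintype.card_ne_zero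
  have hH : (Nat.card H : ℂ) ≠ 0 := Nat.cast_ne_zero.2 Nat.card_pos.ne'
  have htriv : ∑ ψ ∈ (nontrivChars H)ᶜ, ψ (-h) * (u.map (μ.charMean ψ)).prod =
      (Finset.card (nontrivChars H)ᶜ : ℂ) := by
    rw [Finset.card_eq_sum_ones, Nat.cast_sum]
    refine Finset.sum_congr rfl fun ψ hψ => ?_
    simp only [nontrivChars, Finset.compl_filter, Finset.mem_filter, Finset.mem_univ, true_and,
      not_exists, not_and, not_not] at hψ
    rw [hψ _ (H.neg_mem hh), one_mul, List.prod_eq_one]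
    · simp
    · intro c hc
      obtain ⟨x, hx, rfl⟩ := List.mem_map.1 hc
      rw [charMean, Finset.sum_congr rfl fun a _ => by
        rw [hψ _ (H.zsmul_mem (hu x hx) _), mul_one]]
      exact_mod_cast congrArg ((↑) : ℝ → ℂ) μ.sum_weight
  have key : ((μ.sumLaw u h - (Nat.card H : ℝ)⁻¹ : ℝ) : ℂ) = (Fintype.card G : ℂ)⁻¹ *
      ∑ ψ ∈ nontrivChars H, ψ (-h) * (u.map (μ.charMean ψ)).prod := by
    push_cast
    rw [sumLaw_eq_sum_char, ← Finset.sum_add_sum_compl (nontrivChars H), htriv, mul_add,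
      ← card_trivial_chars H]
    have : (Finset.card (nontrivChars H)ᶜ : ℂ) ≠ 0 := by
      intro h0
      have := card_trivial_chars H
      rw [h0, zero_mul] at this
      exact hG this.symm
    field_simp
    ring
  rw [← Real.norm_eq_abs, ← Complex.norm_real, key, norm_mul]
  refine (mul_le_of_le_one_left (norm_nonneg _) ?_).trans ?_
  · rw [norm_inv, Complex.norm_natCast]
    exact inv_le_one_of_one_le₀ (by exact_mod_cast Fintype.card_pos)
  · refine (norm_sum_le _ _).trans (Finset.sum_le_sum fun ψ _ => ?_)
    rw [norm_mul, AddChar.norm_apply, one_mul]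
    exact hθ.norm_prod_le ψ u

/-- Since `Re ψ ≥ -1` off the kernel, the mean of `Re ψ` is at least `2 P(ψ = 1) - 1`, while it is
at most `θ`. -/
lemma sum_sumLaw_ker_le (ψ : AddChar G ℂ) (u : List G) (hu : ∃ x ∈ u, ψ x ≠ 1) :
    ∑ g with ψ g = 1, μ.sumLaw u g ≤ (1 + θ) / 2 := by
  have h1 : (∑ g, (μ.sumLaw u g : ℂ) * ψ g).re ≤ θ := by
    rw [sum_sumLaw_mul_char]
    exact (Complex.re_le_norm _).trans
      ((hθ.norm_prod_le ψ u).trans (charErr_le hθ.pos hθ.lt_one ψ u hu))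
  have h2 : ∑ g, μ.sumLaw u g * (2 * (if ψ g = 1 then 1 else 0) - 1) ≤ θ := by
    refine le_trans ?_ h1
    rw [Complex.re_sum]
    refine Finset.sum_le_sum fun g _ => ?_
    rw [Complex.re_ofReal_mul]
    refine mul_le_mul_of_nonneg_left ?_ (μ.sumLaw_nonneg u g)
    split_ifs with h
    · rw [h]; norm_num
    · have := Complex.abs_re_le_norm (ψ g)
      rw [AddChar.norm_apply, abs_le] at this
      linarith
  have h3 : ∑ g, μ.sumLaw u g * (2 * (if ψ g = 1 then 1 else 0) - 1) =
      2 * ∑ g with ψ g = 1, μ.sumLaw u g - 1 := by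
    conv_rhs => rw [← μ.sum_sumLaw u]
    rw [Finset.sum_filter, Finset.mul_sum, ← Finset.sum_sub_distrib]
    refine Finset.sum_congr rfl fun g _ => ?_
    split_ifs <;> ring
  linarith

end Contracts

end

end CoeffLaw

/-! ### Generated subgroups and histories. -/

/-- The subgroup generated by the entries of a list. -/
def gen {G : Type*} [AddCommGroup G] (u : List G) : AddSubgroup G :=
  AddSubgroup.closure {x | x ∈ u}

section Gen

variable {G : Type*} [AddCommGroup G]

lemma gen_nil : gen ([] : List G) = ⊥ := by simp [gen]

lemma mem_gen {u : List G} {x : G} (hx : x ∈ u) : x ∈ gen u := AddSubgroup.subset_closure hx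

lemma gen_le {u : List G} {H : AddSubgroup G} : gen u ≤ H ↔ ∀ x ∈ u, x ∈ H := by
  simp only [gen, AddSubgroup.closure_le]; rfl

lemma gen_le_cons (x : G) (u : List G) : gen u ≤ gen (x :: u) :=
  gen_le.2 fun _ hy => mem_gen (List.mem_cons_of_mem _ hy)

lemma gen_cons_le {x : G} {u : List G} {H : AddSubgroup G} :
    gen (x :: u) ≤ H ↔ x ∈ H ∧ gen u ≤ H := by
  simp [gen_le]

lemma gen_cons_eq {x : G} {u : List G} {H : AddSubgroup G} (hu : gen u = H) (hx : x ∈ H) :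
    gen (x :: u) = H :=
  le_antisymm (gen_cons_le.2 ⟨hx, hu.le⟩) (hu ▸ gen_le_cons x u)

end Gen

/-- The history `[v_{k-1}, …, v_0]` of a vector at time `k`. -/
def pre {G : Type*} {n : ℕ} (v : Fin n → G) (k : ℕ) : List G := ((List.ofFn v).take k).reverse

lemma pre_snoc_of_le {G : Type*} {n : ℕ} (v : Fin n → G) (x : G) {k : ℕ} (hk : k ≤ n) :
    pre (Fin.snoc v x : Fin (n + 1) → G) k = pre v k := by
  rw [pre, pre, List.ofFn_succ', List.concat_eq_append, List.take_append_of_le_length]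
  · simp
  · simpa using hk

lemma pre_snoc_self {G : Type*} {n : ℕ} (v : Fin n → G) (x : G) :
    pre (Fin.snoc v x : Fin (n + 1) → G) (n + 1) = x :: pre v n := by
  rw [pre, pre, List.ofFn_succ', List.concat_eq_append, List.take_of_length_le (by simp),
    List.take_of_length_le (by simp)]
  simp

lemma mem_of_mem_pre {G : Type*} {n : ℕ} {v : Fin n → G} {k : ℕ} {x : G} (hx : x ∈ pre v k) :
    ∃ i, v i = x := by
  have := List.mem_of_mem_take (List.mem_reverse.1 hx)
  simpa [List.mem_ofFn] using this

/-! ### The transfer operator on histories. -/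

namespace CoeffLaw

variable {ι : Type} [Fintype ι] (μ : CoeffLaw ι)
variable {G : Type*} [AddCommGroup G] [Fintype G]

/-- Extends a history by one further entry in `H`, weighted by the probability that the
corresponding row annihilates it. -/
noncomputable def step (H : AddSubgroup G) : Module.End ℝ (List G → ℝ) where
  toFun f u := ∑ x with x ∈ H, μ.sumLaw (x :: u) 0 * f (x :: u)
  map_add' f g := by
    ext u; simp [mul_add, Finset.sum_add_distrib]
  map_smul' c f := by
    ext u; simp only [Pi.smul_apply, smul_eq_mul, RingHom.id_apply, Finset.mul_sum]
    exact Finset.sum_congr rfl fun x _ => by ring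

lemma step_apply (H : AddSubgroup G) (f : List G → ℝ) (u : List G) :
    μ.step H f u = ∑ x with x ∈ H, μ.sumLaw (x :: u) 0 * f (x :: u) := rfl

lemma step_pow_succ (H : AddSubgroup G) (n : ℕ) (f : List G → ℝ) (u : List G) :
    (μ.step H ^ (n + 1)) f u =
      ∑ x with x ∈ H, μ.sumLaw (x :: u) 0 * (μ.step H ^ n) f (x :: u) := by
  rw [pow_succ', Module.End.mul_apply, step_apply]

lemma step_mono {H : AddSubgroup G} {f g : List G → ℝ} {u : List G}
    (h : ∀ x ∈ H, f (x :: u) ≤ g (x :: u)) : μ.step H f u ≤ μ.step H g u := by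
  rw [step_apply, step_apply]
  exact Finset.sum_le_sum fun x hx => mul_le_mul_of_nonneg_left (h x (by simpa using hx))
    (μ.sumLaw_nonneg _ _)

lemma step_pow_mono {H : AddSubgroup G} {f g : List G → ℝ} {p : List G → Prop}
    (hp : ∀ u, p u → ∀ x ∈ H, p (x :: u)) (hfg : ∀ u, p u → f u ≤ g u) (n : ℕ) {u : List G}
    (hu : p u) : (μ.step H ^ n) f u ≤ (μ.step H ^ n) g u := by
  induction n generalizing u with
  | zero => exact hfg u hu
  | succ n ih =>
    rw [pow_succ', Module.End.mul_apply, Module.End.mul_apply]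
    exact μ.step_mono fun x hx => ih (hp u hu x hx)

lemma step_pow_congr {H : AddSubgroup G} {f g : List G → ℝ} {p : List G → Prop}
    (hp : ∀ u, p u → ∀ x ∈ H, p (x :: u)) (hfg : ∀ u, p u → f u = g u) (n : ℕ) {u : List G}
    (hu : p u) : (μ.step H ^ n) f u = (μ.step H ^ n) g u :=
  le_antisymm (μ.step_pow_mono hp (fun u h => (hfg u h).le) n hu)
    (μ.step_pow_mono hp (fun u h => (hfg u h).ge) n hu)

lemma step_pow_mono_of_le {H : AddSubgroup G} {f g : List G → ℝ} (hfg : ∀ u, f u ≤ g u) (n : ℕ)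
    (u : List G) : (μ.step H ^ n) f u ≤ (μ.step H ^ n) g u :=
  μ.step_pow_mono (p := fun _ => True) (fun _ _ _ _ => trivial) (fun u _ => hfg u) n trivial

lemma step_pow_nonneg {H : AddSubgroup G} {f : List G → ℝ} (hf : ∀ u, 0 ≤ f u) (n : ℕ)
    (u : List G) : 0 ≤ (μ.step H ^ n) f u := by
  have := μ.step_pow_mono_of_le (H := H) (f := 0) (g := f) hf n u
  simpa using this

/-- The crude bound: at most `|G|` choices per step, each of weight at most `1`. -/
lemma step_pow_le_card_pow {H : AddSubgroup G} {f : List G → ℝ} (hf : ∀ u, 0 ≤ f u)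
    (hf' : ∀ x u, f (x :: u) ≤ f u) (n : ℕ) (u : List G) :
    (μ.step H ^ n) f u ≤ (Fintype.card G : ℝ) ^ n * f u := by
  induction n generalizing u with
  | zero => simp
  | succ n ih =>
    rw [step_pow_succ]
    calc _ ≤ ∑ x : G with x ∈ H, (Fintype.card G : ℝ) ^ n * f u := by
          refine Finset.sum_le_sum fun x _ => ?_
          refine (mul_le_of_le_one_left (μ.step_pow_nonneg hf n _) (μ.sumLaw_le_one _ _)).trans ?_
          exact (ih _).trans (mul_le_mul_of_nonneg_left (hf' x u) (by positivity))
      _ ≤ ∑ x : G, (Fintype.card G : ℝ) ^ n * f u :=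
          Finset.sum_le_sum_of_subset_of_nonneg (Finset.subset_univ _)
            fun x _ _ => mul_nonneg (by positivity) (hf u)
      _ = _ := by simp [pow_succ]; ring

/-- Unrolling the iterate enumerates vectors, with one factor per row. Histories carry the newest
entry at the head, so later entries are prepended to `u`. -/
lemma step_pow_eq_sum (K : AddSubgroup G) (n : ℕ) (f : List G → ℝ) (u : List G) :
    (μ.step K ^ n) f u = ∑ v : Fin n → K, (∏ i : Fin n,
      μ.sumLaw (pre (fun j => (v j : G)) (i + 1) ++ u) 0) * f (pre (fun j => (v j : G)) n ++ u) := by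
  induction n generalizing f with
  | zero => simp [pre]
  | succ n ih =>
    rw [pow_succ, Module.End.mul_apply, ih,
      ← (Fin.snocEquiv (fun _ : Fin (n + 1) => K)).sum_comp, Fintype.sum_prod_type,
      Finset.sum_comm]
    refine Finset.sum_congr rfl fun v _ => ?_
    have hs : ∀ x : K, (fun j => ((Fin.snoc v x : Fin (n + 1) → K) j : G)) =
        (Fin.snoc (fun j => (v j : G)) (x : G) : Fin (n + 1) → G) := by
      intro x
      ext j
      refine Fin.lastCases ?_ (fun j => ?_) j <;> simp
    rw [step_apply, Finset.mul_sum, Finset.sum_subtype (p := (· ∈ K)) _ (by simp)]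
    refine Finset.sum_congr rfl fun x _ => ?_
    change _ = (∏ i : Fin (n + 1), μ.sumLaw
      (pre (fun j => ((Fin.snoc v x : Fin (n + 1) → K) j : G)) (i + 1) ++ u) 0) *
      f (pre (fun j => ((Fin.snoc v x : Fin (n + 1) → K) j : G)) (n + 1) ++ u)
    rw [hs, Fin.prod_univ_castSucc, Fin.val_last, pre_snoc_self, List.cons_append, mul_assoc]
    congr 1
    refine Finset.prod_congr rfl fun i _ => ?_
    rw [Fin.val_castSucc, pre_snoc_of_le _ _ (Nat.succ_le_of_lt i.2)]

/-- The expected number of solutions of `L x = s` in `K` is largest for `s = 0`. -/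
def TranslateBound (G : Type*) [AddCommGroup G] [Fintype G] : Prop :=
  ∀ (K : AddSubgroup G) (n : ℕ) (s : Fin n → G),
    ∑ v : Fin n → K, ∏ i : Fin n, μ.sumLaw (pre (fun j => (v j : G)) (i + 1)) (s i) ≤
      ∑ v : Fin n → K, ∏ i : Fin n, μ.sumLaw (pre (fun j => (v j : G)) (i + 1)) 0

lemma sum_sumLaw_mul_eq (K : AddSubgroup G) (z : List G) (hz : ∀ x ∈ z, x ∈ K) (f : G → ℝ) :
    ∑ g, μ.sumLaw z g * f g = ∑ k : K, μ.sumLaw z k * f k := by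
  rw [← Finset.sum_filter_of_ne (p := (· ∈ K)), Finset.sum_subtype (p := (· ∈ K)) _ (by simp)]
  intro x _ hx
  by_contra h
  exact hx (by rw [μ.sumLaw_eq_zero_of_notMem K z hz x h, zero_mul])

variable {μ}

/-- Split each row sum into the part from the new entries, some `k i ∈ K`, and the part from `u`,
which must equal `-k i`. For fixed `k` the new entries solve an inhomogeneous system, bounded by the
homogeneous one; the remaining sum over `k` factors into an `n`-th power. -/
lemma TranslateBound.step_pow_one_le (hT : μ.TranslateBound G) (K : AddSubgroup G) (n : ℕ)
    (u : List G) : (μ.step K ^ n) 1 u ≤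
      (∑ k : K, μ.sumLaw u (-(k : G))) ^ n * (μ.step K ^ n) 1 [] := by
  simp only [step_pow_eq_sum, Pi.one_apply, mul_one, List.append_nil]
  have h : ∀ v : Fin n → K, ∏ i : Fin n,
      μ.sumLaw (pre (fun j => (v j : G)) (i + 1) ++ u) 0 =
      ∑ k : Fin n → K, (∏ i, μ.sumLaw u (-(k i : G))) *
        ∏ i : Fin n, μ.sumLaw (pre (fun j => (v j : G)) (i + 1)) (k i) := by
    intro v
    have : ∀ i : Fin n, μ.sumLaw (pre (fun j => (v j : G)) (i + 1) ++ u) 0 =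
        ∑ k : K, μ.sumLaw u (-(k : G)) * μ.sumLaw (pre (fun j => (v j : G)) (i + 1)) k := by
      intro i
      rw [sumLaw_append, sum_sumLaw_mul_eq μ K]
      · exact Finset.sum_congr rfl fun k _ => by rw [zero_sub, mul_comm]
      · intro x hx
        obtain ⟨i, rfl⟩ := mem_of_mem_pre hx
        exact (v i).2
    simp_rw [this]
    rw [Finset.prod_univ_sum, Fintype.piFinset_univ]
    simp_rw [Finset.prod_mul_distrib]
  simp_rw [h]
  rw [Finset.sum_comm, Fintype.sum_pow, Finset.sum_mul]
  refine Finset.sum_le_sum fun k _ => ?_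
  rw [← Finset.mul_sum]
  exact mul_le_mul_of_nonneg_left (hT K n fun i => k i)
    (Finset.prod_nonneg fun i _ => μ.sumLaw_nonneg _ _)

/-- Here the base of the power is at most the probability that the combination of `u` lies in the
kernel of `ψ`. -/
lemma Contracts.step_pow_one_le {θ : ℝ} (hθ : μ.Contracts G θ) (hT : μ.TranslateBound G)
    {K : AddSubgroup G} {ψ : AddChar G ℂ} (hK : ∀ k ∈ K, ψ k = 1) {u : List G}
    (hu : ∃ x ∈ u, ψ x ≠ 1) (n : ℕ) :
    (μ.step K ^ n) 1 u ≤ ((1 + θ) / 2) ^ n * (μ.step K ^ n) 1 [] := by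
  refine (hT.step_pow_one_le K n u).trans ?_
  refine mul_le_mul_of_nonneg_right ?_ (μ.step_pow_nonneg (fun _ => zero_le_one) _ _)
  refine pow_le_pow_left₀ (Finset.sum_nonneg fun _ _ => μ.sumLaw_nonneg _ _) ?_ n
  refine le_trans ?_ (hθ.sum_sumLaw_ker_le ψ u hu)
  rw [← Finset.sum_image (f := fun g => μ.sumLaw u g) (g := fun k : K => -(k : G))
    (fun a _ b _ h => by simpa using h)]
  refine Finset.sum_le_sum_of_subset_of_nonneg ?_ fun _ _ _ => μ.sumLaw_nonneg _ _
  intro g hg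
  obtain ⟨k, -, rfl⟩ := Finset.mem_image.1 hg
  simpa using hK _ (K.neg_mem k.2)

end CoeffLaw

/-! ### Exponential decay of the mixing error. -/

namespace CoeffLaw

variable {ι : Type} [Fintype ι] {μ : CoeffLaw ι}
variable {G : Type*} [AddCommGroup G] [Fintype G] {θ : ℝ}

/-- The kernel of a character. -/
def kerChar {G : Type*} [AddCommGroup G] (ψ : AddChar G ℂ) : AddSubgroup G where
  carrier := {x | ψ x = 1}
  add_mem' {a b} ha hb := by
    simp only [Set.mem_ofPred_eq] at *
    rw [AddChar.map_add_eq_mul, ha, hb, one_mul]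
  zero_mem' := by simp
  neg_mem' {a} ha := by
    simp only [Set.mem_ofPred_eq] at *
    rw [AddChar.map_neg_eq_inv, ha, inv_one]

lemma mem_kerChar {G : Type*} [AddCommGroup G] {ψ : AddChar G ℂ} {x : G} :
    x ∈ kerChar ψ ↔ ψ x = 1 := Iff.rfl

lemma mem_nontrivChars {H : AddSubgroup G} {ψ : AddChar G ℂ} :
    ψ ∈ nontrivChars H ↔ ∃ x ∈ H, ψ x ≠ 1 := by simp [nontrivChars]

lemma exists_mem_of_mem_nontrivChars {H : AddSubgroup G} {ψ : AddChar G ℂ}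
    (hψ : ψ ∈ nontrivChars H) {u : List G} (hu : gen u = H) : ∃ x ∈ u, ψ x ≠ 1 := by
  by_contra! h
  obtain ⟨x, hx, hx1⟩ := mem_nontrivChars.1 hψ
  have : gen u ≤ kerChar ψ := gen_le.2 h
  rw [hu] at this
  exact hx1 (this hx)

lemma inf_kerChar_lt {H : AddSubgroup G} {ψ : AddChar G ℂ} (hψ : ψ ∈ nontrivChars H) :
    H ⊓ kerChar ψ < H := by
  refine lt_of_le_of_ne inf_le_left fun h => ?_
  obtain ⟨x, hx, hx1⟩ := mem_nontrivChars.1 hψ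
  exact hx1 ((inf_eq_left.1 h) hx)

namespace Contracts

lemma sumLaw_cons_le (hθ : μ.Contracts G θ) {H : AddSubgroup G} {u : List G} (hu : gen u ≤ H)
    {x : G} (hx : x ∈ H) : |μ.sumLaw (x :: u) 0 - (Nat.card H : ℝ)⁻¹| ≤ mixErr θ H u :=
  (hθ.abs_sumLaw_sub_le H (x :: u) (gen_le.1 (gen_cons_le.2 ⟨hx, hu⟩)) 0 H.zero_mem).trans
    (mixErr_cons_le hθ.pos hθ.lt_one H x u)

lemma card_filter_mem (H : AddSubgroup G) :
    ((Finset.univ.filter (· ∈ H)).card : ℝ) = Nat.card H := by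
  rw [Nat.card_eq_fintype_card, Fintype.card_subtype]

lemma card_le (H : AddSubgroup G) : (Nat.card H : ℝ) ≤ Fintype.card G := by
  rw [← card_filter_mem]; exact_mod_cast Finset.card_le_univ _

/-- A uniform entry of `H` leaves the kernel of `ψ` with probability at least `1/|H|` and then gains
the factor `θ`. The deviation of the weights from uniform costs at most `|H| * mixErr`. -/
lemma step_charErr_le (hθ : μ.Contracts G θ) {H : AddSubgroup G} {u : List G} (hu : gen u ≤ H)
    {ψ : AddChar G ℂ} (hψ : ψ ∈ nontrivChars H) :
    μ.step H (charErr θ ψ) u ≤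
      (1 - (1 - θ) / Fintype.card G + Fintype.card G * mixErr θ H u) * charErr θ ψ u := by
  have h0 := hθ.pos
  have h1 := hθ.lt_one
  obtain ⟨y, hy, hy1⟩ := mem_nontrivChars.1 hψ
  set F := mixErr θ H u with hF
  have hF0 : 0 ≤ F := mixErr_nonneg h0 H u
  have hc : (0 : ℝ) < Nat.card H := by exact_mod_cast Nat.card_pos
  have hcG := card_le H
  have hsum : ∑ x with x ∈ H, (if ψ x = 1 then (1 : ℝ) else θ) ≤ Nat.card H - (1 - θ) := by
    have hyH : y ∈ Finset.univ.filter (· ∈ H) := by simpa using hy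
    rw [← Finset.add_sum_erase _ _ hyH, if_neg hy1]
    have : ∑ x ∈ (Finset.univ.filter (· ∈ H)).erase y, (if ψ x = 1 then (1 : ℝ) else θ) ≤
        ((Finset.univ.filter (· ∈ H)).erase y).card • (1 : ℝ) :=
      Finset.sum_le_card_nsmul _ _ _ fun x _ => by split_ifs <;> linarith
    rw [Finset.card_erase_of_mem hyH, nsmul_eq_mul, mul_one,
      Nat.cast_sub (Finset.card_pos.2 ⟨y, hyH⟩), card_filter_mem] at this
    push_cast at this
    linarith
  rw [step_apply]
  calc _ ≤ ∑ x with x ∈ H, (((Nat.card H : ℝ)⁻¹ * (if ψ x = 1 then 1 else θ)) + F) *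
        charErr θ ψ u := by
        refine Finset.sum_le_sum fun x hx => ?_
        rw [charErr_cons, ← mul_assoc]
        refine mul_le_mul_of_nonneg_right ?_ (charErr_pos h0 ψ u).le
        have := (abs_le.1 (hθ.sumLaw_cons_le hu (x := x) (by simpa using hx))).2
        have hi : 0 ≤ (if ψ x = 1 then (1 : ℝ) else θ) ∧ (if ψ x = 1 then (1 : ℝ) else θ) ≤ 1 := by
          split_ifs <;> constructor <;> linarith
        have h3 : μ.sumLaw (x :: u) 0 ≤ (Nat.card H : ℝ)⁻¹ + F := by linarith
        nlinarith [mul_le_mul_of_nonneg_right h3 hi.1, mul_le_of_le_one_right hF0 hi.2]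
    _ = ((Nat.card H : ℝ)⁻¹ * ∑ x with x ∈ H, (if ψ x = 1 then (1 : ℝ) else θ) +
          Nat.card H * F) * charErr θ ψ u := by
        rw [← Finset.sum_mul, Finset.sum_add_distrib, ← Finset.mul_sum, Finset.sum_const,
          nsmul_eq_mul, card_filter_mem]
    _ ≤ _ := by
        refine mul_le_mul_of_nonneg_right ?_ (charErr_pos h0 ψ u).le
        refine add_le_add ?_ (mul_le_mul_of_nonneg_right hcG hF0)
        calc _ ≤ (Nat.card H : ℝ)⁻¹ * (Nat.card H - (1 - θ)) :=
              mul_le_mul_of_nonneg_left hsum (by positivity)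
          _ = 1 - (1 - θ) / Nat.card H := by field_simp
          _ ≤ _ := by
              have := div_le_div_of_nonneg_left (a := 1 - θ) (by linarith) hc hcG
              linarith

/-- Once the law is close to uniform, the mixing error contracts. -/
lemma exists_contraction (hθ : μ.Contracts G θ) (H : AddSubgroup G) :
    ∃ ε r : ℝ, 0 < ε ∧ 0 < r ∧ r < 1 ∧ ∀ u, gen u ≤ H → mixErr θ H u ≤ ε →
      ∀ m, (μ.step H ^ m) (mixErr θ H) u ≤ r ^ m * mixErr θ H u := by
  have h0 := hθ.pos
  have h1 := hθ.lt_one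
  have hg : (1 : ℝ) ≤ Fintype.card G := by exact_mod_cast Fintype.card_pos
  set g : ℝ := (Fintype.card G : ℝ) with hgdef
  have hd : (1 - θ) / g ≤ 1 - θ := div_le_self (by linarith) hg
  have hd0 : 0 < (1 - θ) / g := div_pos (by linarith) (by linarith)
  -- With this `ε` the error term `g * mixErr` uses up at most half of the gap `(1 - θ) / g`; the
  -- other half is the contraction.
  refine ⟨(1 - θ) / g / 2 / g, 1 - (1 - θ) / g / 2, by positivity, by linarith, by linarith,
    fun u hu hF m => ?_⟩
  induction m generalizing u with
  | zero => simp
  | succ m ih =>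
    rw [pow_succ', Module.End.mul_apply]
    calc _ ≤ μ.step H ((1 - (1 - θ) / g / 2) ^ m • mixErr θ H) u := by
          refine μ.step_mono fun x hx => ?_
          exact ih (x :: u) (gen_cons_le.2 ⟨hx, hu⟩) ((mixErr_cons_le h0 h1 H x u).trans hF)
      _ = (1 - (1 - θ) / g / 2) ^ m * ∑ ψ ∈ nontrivChars H, μ.step H (charErr θ ψ) u := by
          rw [map_smul, Pi.smul_apply, smul_eq_mul]
          congr 1
          have : mixErr θ H = ∑ ψ ∈ nontrivChars H, charErr θ ψ := by
            ext v; simp [mixErr]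
          rw [this, map_sum, Finset.sum_apply]
      _ ≤ (1 - (1 - θ) / g / 2) ^ m * ∑ ψ ∈ nontrivChars H,
            (1 - (1 - θ) / g / 2) * charErr θ ψ u := by
          refine mul_le_mul_of_nonneg_left (Finset.sum_le_sum fun ψ hψ => ?_)
            (pow_nonneg (by linarith) m)
          refine (hθ.step_charErr_le hu hψ).trans
            (mul_le_mul_of_nonneg_right ?_ (charErr_pos h0 ψ u).le)
          have : g * mixErr θ H u ≤ (1 - θ) / g / 2 := by
            rw [mul_comm]; exact (le_div_iff₀ (by linarith)).1 hF
          linarith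
      _ = _ := by rw [← Finset.mul_sum, ← mul_assoc, ← pow_succ]; rfl

/-- Split according to the first new entry outside the kernel of `ψ`. If there is none, all entries
lie in `H ⊓ kerChar ψ` and the error is unchanged. Otherwise one of `b` exit times gains `θ ^ s`,
and the crude bound handles everything else. -/
lemma step_pow_charErr_pow_le (hθ : μ.Contracts G θ) (H : AddSubgroup G) (ψ : AddChar G ℂ)
    (s b : ℕ) (u : List G) :
    (μ.step H ^ b) (fun u => charErr θ ψ u ^ s) u ≤
      charErr θ ψ u ^ s *
        ((μ.step (H ⊓ kerChar ψ) ^ b) 1 u + b * θ ^ s * (Fintype.card G : ℝ) ^ b) := by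
  have h0 := hθ.pos
  have h1 := hθ.lt_one
  induction b generalizing u with
  | zero => simp
  | succ b ih =>
    set g : ℝ := (Fintype.card G : ℝ) with hgdef
    have hE : 0 ≤ charErr θ ψ u ^ s := pow_nonneg (charErr_pos h0 ψ u).le s
    rw [step_pow_succ, step_pow_succ]
    calc _ ≤ ∑ x with x ∈ H, (charErr θ ψ u ^ s * (if x ∈ kerChar ψ then
            μ.sumLaw (x :: u) 0 * (μ.step (H ⊓ kerChar ψ) ^ b) 1 (x :: u) else 0) +
            charErr θ ψ u ^ s * ((b + 1) * θ ^ s * g ^ b)) := by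
          refine Finset.sum_le_sum fun x _ => ?_
          have hq0 := μ.sumLaw_nonneg (x :: u) 0
          have hq1 := μ.sumLaw_le_one (x :: u) 0
          have ht : 0 ≤ θ ^ s * g ^ b := by positivity
          have hbt : 0 ≤ b * (θ ^ s * g ^ b) := by positivity
          by_cases hx : x ∈ kerChar ψ
          · rw [if_pos hx]
            have := ih (x :: u)
            rw [charErr_cons, if_pos (mem_kerChar.1 hx), one_mul] at this
            refine (mul_le_mul_of_nonneg_left this hq0).trans ?_
            have h2 : μ.sumLaw (x :: u) 0 * (b * (θ ^ s * g ^ b)) ≤ (b + 1) * (θ ^ s * g ^ b) := by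
              nlinarith
            nlinarith [mul_le_mul_of_nonneg_left h2 hE]
          · rw [if_neg hx, mul_zero, zero_add]
            have := μ.step_pow_le_card_pow (H := H) (f := fun u => charErr θ ψ u ^ s)
              (fun v => pow_nonneg (charErr_pos h0 ψ v).le s)
              (fun y v => pow_le_pow_left₀ (charErr_pos h0 ψ _).le
                (charErr_cons_le h0 h1 ψ y v) s) b (x :: u)
            rw [charErr_cons, if_neg (mt mem_kerChar.2 hx), mul_pow] at this
            have h2 : 0 ≤ g ^ b * (θ ^ s * charErr θ ψ u ^ s) := by positivity
            calc _ ≤ 1 * (g ^ b * (θ ^ s * charErr θ ψ u ^ s)) :=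
                  mul_le_mul hq1 this (μ.step_pow_nonneg
                    (fun v => pow_nonneg (charErr_pos h0 ψ v).le s) _ _) zero_le_one
              _ ≤ _ := by nlinarith [mul_nonneg hE hbt]
      _ = charErr θ ψ u ^ s * (∑ x with x ∈ H ⊓ kerChar ψ,
            μ.sumLaw (x :: u) 0 * (μ.step (H ⊓ kerChar ψ) ^ b) 1 (x :: u)) +
            Nat.card H * (charErr θ ψ u ^ s * ((b + 1) * θ ^ s * g ^ b)) := by
          rw [Finset.sum_add_distrib, ← Finset.mul_sum, Finset.sum_const, nsmul_eq_mul,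
            card_filter_mem, ← Finset.sum_filter, Finset.filter_filter]
          simp only [AddSubgroup.mem_inf]
      _ ≤ _ := by
          rw [mul_add]
          refine add_le_add le_rfl ?_
          have := card_le H
          have h3 : 0 ≤ charErr θ ψ u ^ s * ((b + 1) * θ ^ s * g ^ b) := by positivity
          refine (mul_le_mul_of_nonneg_right this h3).trans (le_of_eq ?_)
          push_cast; ring

end Contracts

/-- The expected number of solutions in `K` grows at most polynomially. -/
def PolyBound (μ : CoeffLaw ι) (K : AddSubgroup G) : Prop :=
  ∃ (C : ℝ) (d : ℕ), ∀ n : ℕ, (μ.step K ^ n) 1 [] ≤ C * ((n : ℝ) + 1) ^ d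

/-- Exponential decay beats polynomial growth: this bounds the weight of staying trapped in `K`. -/
lemma PolyBound.eventually_le {K : AddSubgroup G} (hK : PolyBound μ K) {κ : ℝ} (h0 : 0 < κ)
    (h1 : κ < 1) : ∀ᶠ b : ℕ in atTop, κ ^ b * (μ.step K ^ b) 1 [] ≤ 1 / 4 := by
  obtain ⟨C, d, hC⟩ := hK
  have h := (tendsto_pow_const_mul_const_pow_of_abs_lt_one d (r := κ)
    (by rwa [abs_of_pos h0])).comp (tendsto_add_atTop_nat 1)
  have h2 := h.const_mul (C * κ⁻¹)
  rw [mul_zero] at h2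
  filter_upwards [h2.eventually_lt_const (show (0 : ℝ) < 1 / 4 by norm_num)] with b hb
  refine (mul_le_mul_of_nonneg_left (hC b) (by positivity)).trans (le_trans (le_of_eq ?_) hb.le)
  simp only [Function.comp_apply, pow_succ]
  push_cast
  field_simp

/-- Contraction by `ρ` over blocks of length `b` gives the rate `ρ ^ (1/b)`; the constant absorbs an
incomplete last block. -/
lemma step_pow_le_of_block {H : AddSubgroup G} {Ψ : List G → ℝ} (hΨ : ∀ u, 0 ≤ Ψ u)
    (hΨ' : ∀ x u, Ψ (x :: u) ≤ Ψ u) {b : ℕ} (hb : 0 < b) {ρ : ℝ} (h0 : 0 < ρ) (h1 : ρ < 1)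
    (h : ∀ u, gen u = H → (μ.step H ^ b) Ψ u ≤ ρ * Ψ u) :
    ∃ C r : ℝ, 0 ≤ C ∧ 0 < r ∧ r < 1 ∧ ∀ u, gen u = H → ∀ m,
      (μ.step H ^ m) Ψ u ≤ C * r ^ m * Ψ u := by
  have hg : (1 : ℝ) ≤ Fintype.card G := by exact_mod_cast Fintype.card_pos
  set g : ℝ := (Fintype.card G : ℝ) with hgdef
  have hrb : (ρ ^ ((b : ℝ)⁻¹)) ^ b = ρ := Real.rpow_inv_natCast_pow h0.le hb.ne'
  have hr0 : 0 < ρ ^ ((b : ℝ)⁻¹) := Real.rpow_pos_of_pos h0 _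
  have hr1 : ρ ^ ((b : ℝ)⁻¹) < 1 := Real.rpow_lt_one h0.le h1 (by positivity)
  set r := ρ ^ ((b : ℝ)⁻¹)
  refine ⟨g ^ b * ρ⁻¹, r, by positivity, hr0, hr1, fun u hu m => ?_⟩
  induction m using Nat.strong_induction_on generalizing u with
  | _ m ih =>
    by_cases hm : m < b
    · refine (μ.step_pow_le_card_pow hΨ hΨ' m u).trans (mul_le_mul_of_nonneg_right ?_ (hΨ u))
      have h2 : ρ ≤ r ^ m := by
        rw [← hrb]; exact pow_le_pow_of_le_one hr0.le hr1.le hm.le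
      have h3 : 1 ≤ ρ⁻¹ * r ^ m := by
        rw [inv_mul_eq_div]; exact (one_le_div h0).2 h2
      rw [mul_assoc]
      exact (pow_le_pow_right₀ hg hm.le).trans (le_mul_of_one_le_right (by positivity) h3)
    · obtain ⟨k, rfl⟩ := Nat.exists_eq_add_of_le (not_lt.1 hm)
      rw [add_comm, pow_add, Module.End.mul_apply]
      calc _ ≤ (μ.step H ^ k) (ρ • Ψ) u :=
            μ.step_pow_mono (p := fun u => gen u = H) (fun u hu x hx => gen_cons_eq hu hx) h k hu
        _ = ρ * (μ.step H ^ k) Ψ u := by rw [map_smul]; rfl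
        _ ≤ ρ * (g ^ b * ρ⁻¹ * r ^ k * Ψ u) :=
            mul_le_mul_of_nonneg_left (ih k (by omega) u hu) h0.le
        _ = _ := by rw [pow_add r, hrb]; ring

/-- A Lyapunov argument. `mixErr` contracts only once it is small, so a multiple of `Y = ∑ charErr ^
s` is added to it. `Y` contracts over blocks from every history generating `H`, since no character
nontrivial on `H` is trivial on such a history, and it dominates the growth of `mixErr` while that
is large. -/
lemma Contracts.exists_decay (hθ : μ.Contracts G θ) (hT : μ.TranslateBound G) (H : AddSubgroup G)
    (hpoly : ∀ K < H, PolyBound μ K) :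
    ∃ C r : ℝ, 0 ≤ C ∧ 0 < r ∧ r < 1 ∧ ∀ u, gen u = H → ∀ m,
      (μ.step H ^ m) (mixErr θ H) u ≤ C * r ^ m := by
  have h0 := hθ.pos
  have h1 := hθ.lt_one
  obtain ⟨ε, r₁, hε, hr0, hr1, hcontr⟩ := hθ.exists_contraction H
  have hg : (1 : ℝ) ≤ Fintype.card G := by exact_mod_cast Fintype.card_pos
  set g : ℝ := (Fintype.card G : ℝ) with hgdef
  -- First `b` makes trapping in any proper subgroup unlikely; then `s`, depending on `b`, makes the
  -- escape term small. Together they give the factor `1/2` for `Y`.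
  obtain ⟨b, hb, hbpos⟩ : ∃ b : ℕ, (∀ K : AddSubgroup G, K < H →
      ((1 + θ) / 2) ^ b * (μ.step K ^ b) 1 [] ≤ 1 / 4) ∧ 0 < b := by
    have := (eventually_all.2 fun K : AddSubgroup G => eventually_imp_distrib_left.2 fun hK : K < H =>
      (hpoly K hK).eventually_le (κ := (1 + θ) / 2) (by linarith) (by linarith))
    exact (this.and (eventually_gt_atTop 0)).exists
  obtain ⟨s, hs⟩ : ∃ s : ℕ, b * θ ^ s * g ^ b ≤ 1 / 4 := by
    have := ((tendsto_pow_atTop_nhds_zero_of_lt_one h0.le h1).const_mul (b : ℝ)).mul_const (g ^ b)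
    rw [mul_zero, zero_mul] at this
    exact ((this.eventually_lt_const (show (0 : ℝ) < 1 / 4 by norm_num)).exists).imp
      fun s hs => hs.le
  set X := nontrivChars H with hX
  set N : ℝ := X.card + 1 with hN
  have hN0 : 0 < N := by positivity
  set Y : List G → ℝ := ∑ ψ ∈ X, fun u => charErr θ ψ u ^ s with hY
  have hYu : ∀ u, Y u = ∑ ψ ∈ X, charErr θ ψ u ^ s := fun u => by simp [hY]
  have hY0 : ∀ u, 0 ≤ Y u := fun u => by
    rw [hYu]; exact Finset.sum_nonneg fun ψ _ => pow_nonneg (charErr_pos h0 ψ u).le s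
  have hYc : ∀ x u, Y (x :: u) ≤ Y u := fun x u => by
    rw [hYu, hYu]
    exact Finset.sum_le_sum fun ψ _ => pow_le_pow_left₀ (charErr_pos h0 ψ _).le
      (charErr_cons_le h0 h1 ψ x u) s
  have hYb : ∀ u, Y u ≤ N := fun u => by
    rw [hYu]
    refine (Finset.sum_le_card_nsmul _ _ 1 fun ψ _ => pow_le_one₀ (charErr_pos h0 ψ u).le
      (charErr_le_one h0 h1 ψ u)).trans ?_
    rw [nsmul_eq_mul]; linarith
  have hF0 : ∀ u, 0 ≤ mixErr θ H u := mixErr_nonneg h0 H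
  have hFb : ∀ u, mixErr θ H u ≤ N := fun u => by
    refine (Finset.sum_le_card_nsmul _ _ 1 fun ψ _ => charErr_le_one h0 h1 ψ u).trans ?_
    rw [nsmul_eq_mul]; linarith
  have hYstep : ∀ u, gen u = H → (μ.step H ^ b) Y u ≤ 1 / 2 * Y u := by
    intro u hu
    rw [hY, map_sum, Finset.sum_apply, Finset.sum_apply, Finset.mul_sum]
    refine Finset.sum_le_sum fun ψ hψ => ?_
    refine (hθ.step_pow_charErr_pow_le H ψ s b u).trans ?_
    rw [mul_comm]
    refine mul_le_mul_of_nonneg_right ?_ (pow_nonneg (charErr_pos h0 ψ u).le s)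
    have h2 := hθ.step_pow_one_le hT (K := H ⊓ kerChar ψ) (ψ := ψ) (fun k hk => hk.2)
      (exists_mem_of_mem_nontrivChars hψ hu) b
    have h3 := hb _ (inf_kerChar_lt hψ)
    linarith
  -- If `mixErr > ε`, some `charErr` exceeds `ε / N`, so `Y ≥ (ε / N) ^ s`, and `D * Y` covers the
  -- crude bound `g ^ b * N`.
  set D : ℝ := g ^ b * N / (ε / N) ^ s with hD
  have hD0 : 0 < D := by positivity
  have hFstep : ∀ u, gen u = H → (μ.step H ^ b) (mixErr θ H) u ≤ r₁ * mixErr θ H u + D * Y u := by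
    intro u hu
    by_cases hF : mixErr θ H u ≤ ε
    · have h2 := hcontr u hu.le hF b
      have h3 : r₁ ^ b ≤ r₁ := pow_le_of_le_one hr0.le hr1.le hbpos.ne'
      have h4 := mul_le_mul_of_nonneg_right h3 (hF0 u)
      have h5 := mul_nonneg hD0.le (hY0 u)
      linarith
    · push Not at hF
      have h2 : (ε / N) ^ s ≤ Y u := by
        by_contra! hlt
        have h3 : ∀ ψ ∈ X, charErr θ ψ u ≤ ε / N := by
          intro ψ hψ
          by_contra! h4
          have h5 := Finset.single_le_sum (f := fun ψ => charErr θ ψ u ^ s)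
            (fun ψ _ => pow_nonneg (charErr_pos h0 ψ u).le s) hψ
          rw [← hYu] at h5
          exact absurd (pow_le_pow_left₀ (by positivity) h4.le s) (by simpa using h5.trans_lt hlt)
        have h4 := Finset.sum_le_card_nsmul _ _ _ h3
        rw [nsmul_eq_mul] at h4
        have h5 : (X.card : ℝ) * (ε / N) ≤ ε := by
          rw [mul_div_assoc', div_le_iff₀ hN0, mul_comm]
          exact mul_le_mul_of_nonneg_left (by linarith) hε.le
        exact absurd (h4.trans h5) (not_le.2 hF)
      have h3 := μ.step_pow_le_card_pow (H := H) hF0 (mixErr_cons_le h0 h1 H) b u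
      have h4 : g ^ b * mixErr θ H u ≤ g ^ b * N :=
        mul_le_mul_of_nonneg_left (hFb u) (by positivity)
      have h5 : g ^ b * N ≤ D * Y u := by
        rw [hD, div_mul_eq_mul_div, le_div_iff₀ (by positivity)]
        exact mul_le_mul_of_nonneg_left h2 (by positivity)
      have h6 := mul_nonneg hr0.le (hF0 u)
      linarith
  -- One block turns the coefficient of `Y` into at most `D + 4 * D / 2 = 3 * D`, which is `3/4` of
  -- the original `4 * D`.
  obtain ⟨C, r, hC, hr, hr', hCr⟩ := step_pow_le_of_block (μ := μ) (H := H)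
    (Ψ := mixErr θ H + (4 * D) • Y) (b := b) (ρ := max r₁ (3 / 4))
    (fun u => add_nonneg (hF0 u) (mul_nonneg (by positivity) (hY0 u)))
    (fun x u => add_le_add (mixErr_cons_le h0 h1 H x u)
      (mul_le_mul_of_nonneg_left (hYc x u) (by positivity))) hbpos (lt_max_of_lt_left hr0)
    (max_lt hr1 (by norm_num)) (by
      intro u hu
      rw [map_add, map_smul]
      simp only [Pi.add_apply, Pi.smul_apply, smul_eq_mul]
      have h2 := hFstep u hu
      have h3 := mul_le_mul_of_nonneg_left (hYstep u hu) hD0.le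
      have h4 := mul_le_mul_of_nonneg_right (le_max_left r₁ (3 / 4)) (hF0 u)
      have h5 := mul_le_mul_of_nonneg_right (le_max_right r₁ (3 / 4)) (mul_nonneg hD0.le (hY0 u))
      nlinarith)
  refine ⟨C * (N + 4 * D * N), r, by positivity, hr, hr', fun u hu m => ?_⟩
  calc _ ≤ (μ.step H ^ m) (mixErr θ H + (4 * D) • Y) u :=
        μ.step_pow_mono_of_le (fun u => le_add_of_nonneg_right
          (mul_nonneg (by positivity) (hY0 u))) m u
    _ ≤ _ := hCr u hu m
    _ ≤ C * r ^ m * (N + 4 * D * N) := by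
        refine mul_le_mul_of_nonneg_left (add_le_add (hFb u) ?_) (by positivity)
        exact mul_le_mul_of_nonneg_left (hYb u) (by positivity)
    _ = _ := by ring

end CoeffLaw

/-! ### Polynomial growth. -/

/-- Sequences bounded above by a polynomial. -/
def PolyGrowth (f : ℕ → ℝ) : Prop := ∃ (C : ℝ) (d : ℕ), ∀ n : ℕ, f n ≤ C * ((n : ℝ) + 1) ^ d

namespace PolyGrowth

lemma exists_nonneg {f : ℕ → ℝ} (hf : PolyGrowth f) :
    ∃ (C : ℝ) (d : ℕ), 0 ≤ C ∧ ∀ n : ℕ, f n ≤ C * ((n : ℝ) + 1) ^ d := by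
  obtain ⟨C, d, h⟩ := hf
  exact ⟨|C|, d, abs_nonneg C, fun n => (h n).trans
    (mul_le_mul_of_nonneg_right (le_abs_self C) (by positivity))⟩

lemma mono {f g : ℕ → ℝ} (hg : PolyGrowth g) (h : ∀ n, f n ≤ g n) : PolyGrowth f :=
  let ⟨C, d, hC⟩ := hg
  ⟨C, d, fun n => (h n).trans (hC n)⟩

lemma const (c : ℝ) : PolyGrowth fun _ => c := ⟨c, 0, fun n => by simp⟩

lemma add {f g : ℕ → ℝ} (hf : PolyGrowth f) (hg : PolyGrowth g) :
    PolyGrowth fun n => f n + g n := by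
  obtain ⟨C, d, hC, h⟩ := hf.exists_nonneg
  obtain ⟨C', d', hC', h'⟩ := hg.exists_nonneg
  refine ⟨C + C', d + d', fun n => ?_⟩
  have hn : (1 : ℝ) ≤ (n : ℝ) + 1 := by linarith [n.cast_nonneg (α := ℝ)]
  rw [add_mul]
  exact add_le_add ((h n).trans (mul_le_mul_of_nonneg_left (pow_le_pow_right₀ hn (by omega)) hC))
    ((h' n).trans (mul_le_mul_of_nonneg_left (pow_le_pow_right₀ hn (by omega)) hC'))

lemma const_mul {f : ℕ → ℝ} (hf : PolyGrowth f) {c : ℝ} (hc : 0 ≤ c) :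
    PolyGrowth fun n => c * f n := by
  obtain ⟨C, d, h⟩ := hf
  exact ⟨c * C, d, fun n => by rw [mul_assoc]; exact mul_le_mul_of_nonneg_left (h n) hc⟩

lemma sum {α : Type*} {s : Finset α} {f : α → ℕ → ℝ} (hf : ∀ a ∈ s, PolyGrowth (f a)) :
    PolyGrowth fun n => ∑ a ∈ s, f a n := by
  induction s using Finset.induction_on with
  | empty => simpa using const 0
  | insert a s ha ih =>
    simp_rw [Finset.sum_insert ha]
    exact (hf a (Finset.mem_insert_self a s)).add
      (ih fun b hb => hf b (Finset.mem_insert_of_mem hb))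

lemma sum_range {f : ℕ → ℝ} (hf : PolyGrowth f) :
    PolyGrowth fun n => ∑ k ∈ Finset.range n, f k := by
  obtain ⟨C, d, hC, h⟩ := hf.exists_nonneg
  refine ⟨C, d + 1, fun n => ?_⟩
  calc _ ≤ ∑ k ∈ Finset.range n, C * ((n : ℝ) + 1) ^ d := by
        refine Finset.sum_le_sum fun k hk => (h k).trans (mul_le_mul_of_nonneg_left ?_ hC)
        have : (k : ℝ) ≤ n := by exact_mod_cast (Finset.mem_range.1 hk).le
        exact pow_le_pow_left₀ (by positivity) (by linarith) d
    _ = n * (C * ((n : ℝ) + 1) ^ d) := by simp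
    _ ≤ _ := by
        rw [pow_succ]
        have : 0 ≤ C * ((n : ℝ) + 1) ^ d := by positivity
        nlinarith

end PolyGrowth

/-! ### Decomposition of the weight by generated subgroup. -/

/-- Restriction of a function to the lists generating `H`. -/
noncomputable def genInd {G : Type*} [AddCommGroup G] (H : AddSubgroup G) (f : List G → ℝ)
    (u : List G) : ℝ := if gen u = H then f u else 0

lemma genInd_of_eq {G : Type*} [AddCommGroup G] {H : AddSubgroup G} {f : List G → ℝ} {u : List G}
    (h : gen u = H) : genInd H f u = f u := if_pos h

lemma genInd_of_ne {G : Type*} [AddCommGroup G] {H : AddSubgroup G} {f : List G → ℝ} {u : List G}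
    (h : gen u ≠ H) : genInd H f u = 0 := if_neg h

lemma genInd_nonneg {G : Type*} [AddCommGroup G] (H : AddSubgroup G) {f : List G → ℝ}
    (hf : ∀ u, 0 ≤ f u) (u : List G) : 0 ≤ genInd H f u := by
  unfold genInd; split_ifs <;> simp [hf]

namespace CoeffLaw

variable {ι : Type} [Fintype ι] {μ : CoeffLaw ι}
variable {G : Type*} [AddCommGroup G] [Fintype G] {θ : ℝ}

/-- Near conservation of weight: `|H|` possible entries, each of weight within `mixErr` of `1/|H|`.
-/
lemma Contracts.abs_step_one_sub_le (hθ : μ.Contracts G θ) {H : AddSubgroup G} {u : List G}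
    (hu : gen u ≤ H) : |μ.step H 1 u - 1| ≤ Fintype.card G * mixErr θ H u := by
  have hc : (Nat.card H : ℝ) ≠ 0 := by exact_mod_cast Nat.card_pos.ne'
  have h1 : μ.step H 1 u - 1 = ∑ x with x ∈ H, (μ.sumLaw (x :: u) 0 - (Nat.card H : ℝ)⁻¹) := by
    rw [step_apply, Finset.sum_sub_distrib, Finset.sum_const, nsmul_eq_mul, card_filter_mem,
      mul_inv_cancel₀ hc]
    simp
  rw [h1]
  refine (Finset.abs_sum_le_sum_abs _ _).trans ?_
  calc _ ≤ ∑ x with x ∈ H, mixErr θ H u :=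
        Finset.sum_le_sum fun x hx => hθ.sumLaw_cons_le hu (by simpa using hx)
    _ = Nat.card H * mixErr θ H u := by
        rw [Finset.sum_const, nsmul_eq_mul, card_filter_mem]
    _ ≤ _ := mul_le_mul_of_nonneg_right (card_le H) (mixErr_nonneg hθ.pos H u)

lemma Contracts.abs_step_pow_succ_sub_le (hθ : μ.Contracts G θ) {H : AddSubgroup G} {u : List G}
    (hu : gen u ≤ H) (m : ℕ) : |(μ.step H ^ (m + 1)) 1 u - (μ.step H ^ m) 1 u| ≤
      Fintype.card G * (μ.step H ^ m) (mixErr θ H) u := by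
  have h1 : (μ.step H ^ (m + 1)) 1 u - (μ.step H ^ m) 1 u =
      (μ.step H ^ m) (μ.step H 1 - 1) u := by
    rw [map_sub, pow_succ, Module.End.mul_apply]; rfl
  have hp : ∀ u : List G, gen u ≤ H → ∀ x ∈ H, gen (x :: u) ≤ H :=
    fun u hu x hx => gen_cons_le.2 ⟨hx, hu⟩
  have h2 := μ.step_pow_mono hp (f := μ.step H 1 - 1) (g := (Fintype.card G : ℝ) • mixErr θ H)
    (fun v hv => (abs_le.1 (hθ.abs_step_one_sub_le hv)).2) m hu
  have h3 := μ.step_pow_mono hp (f := -((Fintype.card G : ℝ) • mixErr θ H)) (g := μ.step H 1 - 1)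
    (fun v hv => (abs_le.1 (hθ.abs_step_one_sub_le hv)).1) m hu
  rw [map_neg] at h3
  rw [map_smul] at h2 h3
  rw [h1, abs_le]
  exact ⟨h3, h2⟩

lemma abs_sub_le_of_geometric {f : ℕ → ℝ} {C r : ℝ} (h0 : 0 < r) (h1 : r < 1)
    (hf : ∀ m, |f (m + 1) - f m| ≤ C * r ^ m) (m k : ℕ) :
    |f (m + k) - f m| ≤ C / (1 - r) * r ^ m := by
  have h1' : 0 < 1 - r := by linarith
  have hC : 0 ≤ C := by simpa using (abs_nonneg _).trans (hf 0)
  have : |f (m + k) - f m| ≤ C / (1 - r) * (r ^ m - r ^ (m + k)) := by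
    induction k with
    | zero => simp
    | succ k ih =>
      have h2 := abs_sub_le (f (m + (k + 1))) (f (m + k)) (f m)
      have h3 := hf (m + k)
      have h4 : C / (1 - r) * (r ^ m - r ^ (m + (k + 1))) =
          C / (1 - r) * (r ^ m - r ^ (m + k)) + C * r ^ (m + k) := by
        rw [← add_assoc, pow_succ]; field_simp; ring
      rw [h4]
      rw [← add_assoc] at *
      linarith
  refine this.trans (mul_le_mul_of_nonneg_left ?_ (by positivity))
  linarith [pow_pos h0 (m + k)]

variable (μ) in
/-- The weight of histories of length `n` generating `H`. -/
noncomputable def genWeight (H : AddSubgroup G) (n : ℕ) : ℝ := (μ.step ⊤ ^ n) (genInd H 1) []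

/-- Uniform exponential mixing of the histories generating `H`. -/
def Mixes (μ : CoeffLaw ι) (θ : ℝ) (H : AddSubgroup G) : Prop :=
  ∃ C r : ℝ, 0 ≤ C ∧ 0 < r ∧ r < 1 ∧ (∀ u, gen u = H → ∀ m,
    (μ.step H ^ m) (mixErr θ H) u ≤ C * r ^ m) ∧ (∀ u, gen u = H → ∀ m k,
    |(μ.step H ^ (m + k)) 1 u - (μ.step H ^ m) 1 u| ≤ C * r ^ m) ∧
    (∀ u, gen u = H → ∀ m, (μ.step H ^ m) 1 u ≤ C)

/-- The change of total weight in one step is bounded by an averaged `mixErr`, which decays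
geometrically; telescoping gives the Cauchy estimate and the uniform bound. -/
lemma Contracts.mixes_of_polyBound (hθ : μ.Contracts G θ) (hT : μ.TranslateBound G)
    (H : AddSubgroup G) (hpoly : ∀ K < H, PolyBound μ K) : Mixes μ θ H := by
  obtain ⟨C, r, hC, hr0, hr1, h⟩ := hθ.exists_decay hT H hpoly
  have hg : (0 : ℝ) ≤ Fintype.card G := by positivity
  have hr : 0 < 1 - r := by linarith
  set D := Fintype.card G * C / (1 - r) with hD
  have hD0 : 0 ≤ D := by positivity
  have h2 : ∀ u, gen u = H → ∀ m k,
      |(μ.step H ^ (m + k)) 1 u - (μ.step H ^ m) 1 u| ≤ D * r ^ m := by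
    intro u hu m k
    refine abs_sub_le_of_geometric (f := fun m => (μ.step H ^ m) 1 u) hr0 hr1 (fun m => ?_) m k
    refine (hθ.abs_step_pow_succ_sub_le hu.le m).trans ?_
    rw [mul_assoc]
    exact mul_le_mul_of_nonneg_left (h u hu m) hg
  refine ⟨C + (1 + D), r, by positivity, hr0, hr1, fun u hu m => ?_, fun u hu m k => ?_,
    fun u hu m => ?_⟩
  · exact (h u hu m).trans (mul_le_mul_of_nonneg_right (by linarith) (by positivity))
  · exact (h2 u hu m k).trans (mul_le_mul_of_nonneg_right (by linarith) (by positivity))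
  · have := (abs_le.1 (h2 u hu 0 m)).2
    simp at this
    linarith

lemma step_pow_eq_zero_of_not_le {H H' : AddSubgroup G} {f : List G → ℝ}
    (hf : ∀ u, ¬ gen u ≤ H → f u = 0) (n : ℕ) {u : List G} (hu : ¬ gen u ≤ H) :
    (μ.step H' ^ n) f u = 0 := by
  have := μ.step_pow_congr (H := H') (f := f) (g := 0) (p := fun u => ¬ gen u ≤ H)
    (fun v hv x _ h => hv ((gen_le_cons x v).trans h)) hf n hu
  simpa using this

/-- A history that leaves `H` never returns, so restricting every step to `H` amounts to one
indicator at the end. -/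
lemma step_pow_eq_step_top_pow {H : AddSubgroup G} (f : List G → ℝ) (n : ℕ) {u : List G}
    (hu : gen u ≤ H) : (μ.step H ^ n) f u =
      (μ.step ⊤ ^ n) (fun v => if gen v ≤ H then f v else 0) u := by
  induction n generalizing u with
  | zero => simp [hu]
  | succ n ih =>
    rw [step_pow_succ, step_pow_succ]
    have : ∀ x : G, x ∈ Finset.univ.filter (fun x : G => x ∈ (⊤ : AddSubgroup G)) →
        μ.sumLaw (x :: u) 0 * (μ.step ⊤ ^ n) (fun v => if gen v ≤ H then f v else 0) (x :: u) ≠ 0 →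
        x ∈ H := by
      intro x _ hx
      by_contra hxH
      refine hx ?_
      rw [step_pow_eq_zero_of_not_le (H := H) (fun v hv => if_neg hv) n, mul_zero]
      exact fun h => hxH (gen_cons_le.1 h).1
    rw [← Finset.sum_filter_of_ne this, Finset.filter_filter]
    simp only [AddSubgroup.mem_top, true_and]
    refine Finset.sum_congr rfl fun x hx => ?_
    rw [ih (gen_cons_le.2 ⟨by simpa using hx, hu⟩)]

lemma step_pow_nil_eq_sum_genWeight (H : AddSubgroup G) (n : ℕ) :
    (μ.step H ^ n) 1 [] = ∑ K with K ≤ H, μ.genWeight K n := by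
  rw [step_pow_eq_step_top_pow _ _ (by rw [gen_nil]; exact bot_le)]
  have : (fun v : List G => if gen v ≤ H then (1 : List G → ℝ) v else 0) =
      ∑ K with K ≤ H, genInd K 1 := by
    ext v
    simp only [Finset.sum_apply, genInd, Finset.sum_ite_eq, Finset.mem_filter, Finset.mem_univ,
      true_and]
  rw [this, map_sum, Finset.sum_apply]
  rfl

lemma step_top_genInd_of_eq {H : AddSubgroup G} (g : List G → ℝ) {u : List G} (hu : gen u = H) :
    μ.step ⊤ (genInd H g) u = μ.step H g u := by
  rw [step_apply, step_apply]
  have : ∀ x : G, x ∈ Finset.univ.filter (fun x : G => x ∈ (⊤ : AddSubgroup G)) →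
      μ.sumLaw (x :: u) 0 * genInd H g (x :: u) ≠ 0 → x ∈ H := by
    intro x _ hx
    by_contra hxH
    refine hx ?_
    rw [genInd_of_ne, mul_zero]
    exact fun h => hxH (gen_cons_le.1 h.le).1
  rw [← Finset.sum_filter_of_ne this, Finset.filter_filter]
  simp only [AddSubgroup.mem_top, true_and]
  refine Finset.sum_congr rfl fun x hx => ?_
  rw [genInd_of_eq (gen_cons_eq hu (by simpa using hx))]

lemma step_top_genInd_of_not_le {H : AddSubgroup G} (g : List G → ℝ) {u : List G}
    (hu : ¬ gen u ≤ H) : μ.step ⊤ (genInd H g) u = 0 := by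
  have := step_pow_eq_zero_of_not_le (μ := μ) (H := H) (H' := ⊤) (f := genInd H g)
    (fun v hv => genInd_of_ne fun h => hv h.le) 1 hu
  simpa using this

/-- Decomposition according to the last time at which the generated subgroup changes. -/
lemma step_top_pow_genInd_eq (H : AddSubgroup G) (f : List G → ℝ) (n : ℕ) :
    (μ.step ⊤ ^ n) (genInd H f) [] = genInd H ((μ.step H ^ n) f) [] +
      ∑ k ∈ Finset.range n, ∑ H' with H' < H,
        (μ.step ⊤ ^ k) (genInd H' (μ.step ⊤ (genInd H ((μ.step H ^ (n - 1 - k)) f)))) [] := by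
  -- Telescope in the time `k` at which `step ⊤` is replaced by `step H`. Consecutive terms differ
  -- by one step taken from a proper subgroup into `H`.
  have htel := Finset.sum_range_sub
    (fun k => (μ.step ⊤ ^ k) (genInd H ((μ.step H ^ (n - k)) f)) []) n
  simp only [Nat.sub_self, pow_zero, Module.End.one_apply, Nat.sub_zero] at htel
  rw [← sub_eq_iff_eq_add', ← htel]
  refine Finset.sum_congr rfl fun k hk => ?_
  have hk' := Finset.mem_range.1 hk
  obtain ⟨m, hm⟩ : ∃ m, m = n - 1 - k := ⟨_, rfl⟩
  rw [← hm, show n - (k + 1) = m by omega, show n - k = m + 1 by omega]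
  set g := (μ.step H ^ m) f with hg
  have hfun : μ.step ⊤ (genInd H g) - genInd H (μ.step H g) =
      ∑ H' with H' < H, genInd H' (μ.step ⊤ (genInd H g)) := by
    ext u
    simp only [Pi.sub_apply, Finset.sum_apply, genInd.eq_1, Finset.sum_ite_eq, Finset.mem_filter,
      Finset.mem_univ, true_and]
    simp only [← genInd.eq_1]
    change μ.step ⊤ (genInd H g) u - _ = if gen u < H then μ.step ⊤ (genInd H g) u else 0
    by_cases h1 : gen u = H
    · rw [step_top_genInd_of_eq g h1, genInd_of_eq h1, if_neg (by rw [h1]; exact lt_irrefl _), sub_self]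
    · rw [genInd_of_ne h1, sub_zero]
      by_cases h2 : gen u < H
      · rw [if_pos h2]
      · rw [if_neg h2, step_top_genInd_of_not_le g fun h => h2 (lt_of_le_of_ne h h1)]
  rw [pow_succ, Module.End.mul_apply, pow_succ' (μ.step H) m, Module.End.mul_apply, ← hg,
    ← Pi.sub_apply, ← map_sub, hfun, map_sum, Finset.sum_apply]

lemma genWeight_nonneg (H : AddSubgroup G) (n : ℕ) : 0 ≤ μ.genWeight H n :=
  μ.step_pow_nonneg (genInd_nonneg H fun _ => zero_le_one) n _

lemma genWeight_bot (n : ℕ) : μ.genWeight (⊥ : AddSubgroup G) n = 1 := by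
  have h : ∀ n, ∀ u : List G, gen u = ⊥ → (μ.step ⊥ ^ n) 1 u = 1 := by
    intro n
    induction n with
    | zero => intro u _; simp
    | succ n ih =>
      intro u hu
      rw [step_pow_succ, Finset.sum_eq_single_of_mem 0 (by simp)
        (fun x hx h => absurd (by simpa using hx) h)]
      have hu' : gen ((0 : G) :: u) = ⊥ := gen_cons_eq hu (AddSubgroup.zero_mem _)
      rw [ih _ hu', sumLaw_eq_one_of_forall_eq_zero, one_mul]
      exact fun x hx => by simpa [hu'] using mem_gen hx
  have h2 := step_pow_nil_eq_sum_genWeight (μ := μ) (⊥ : AddSubgroup G) n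
  rw [h n _ gen_nil] at h2
  rw [h2, Finset.sum_eq_single_of_mem ⊥ (by simp)]
  intro K hK hK'
  exact absurd (le_bot_iff.1 (by simpa using hK)) hK'

/-- The one-step weight of a jump into `H` is bounded in terms of a bound on `H`. -/
lemma step_top_genInd_le {H : AddSubgroup G} {g : List G → ℝ} {D : ℝ} (hD : 0 ≤ D)
    (hg : ∀ u, gen u = H → g u ≤ D) (u : List G) :
    μ.step ⊤ (genInd H g) u ≤ Fintype.card G * D := by
  have h : ∀ v, genInd H g v ≤ D := fun v => by
    by_cases h : gen v = H
    · rw [genInd_of_eq h]; exact hg v h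
    · rw [genInd_of_ne h]; exact hD
  calc _ ≤ (μ.step ⊤ ^ 1) (fun _ => D) u := by
        rw [pow_one]; exact μ.step_mono fun x _ => h _
    _ ≤ _ := by simpa using μ.step_pow_le_card_pow (H := ⊤) (fun _ => hD) (fun _ _ => le_rfl) 1 u

lemma step_pow_genInd_le {H : AddSubgroup G} {g : List G → ℝ} {D : ℝ}
    (hg : ∀ u, gen u = H → g u ≤ D) (k : ℕ) :
    (μ.step ⊤ ^ k) (genInd H g) [] ≤ D * μ.genWeight H k := by
  have : (μ.step ⊤ ^ k) (D • genInd H 1) [] = D * μ.genWeight H k := by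
    rw [map_smul]; rfl
  rw [← this]
  refine μ.step_pow_mono_of_le (fun u => ?_) k []
  by_cases h : gen u = H
  · simp only [Pi.smul_apply, genInd_of_eq h, Pi.one_apply, smul_eq_mul, mul_one]; exact hg u h
  · simp [genInd_of_ne h]

omit [Fintype G] in
lemma genInd_nil_of_ne_bot {H : AddSubgroup G} (hH : H ≠ ⊥) (f : List G → ℝ) :
    genInd H f [] = 0 := genInd_of_ne (by rw [gen_nil]; exact hH.symm)

/-- Induction on `H`. Mixing on `H` needs polynomial bounds for proper subgroups only, and it bounds
each term of the last-jump decomposition by a constant times the weight of `H'`; summing over time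
raises the degree by one. -/
lemma Contracts.polyGrowth_genWeight (hθ : μ.Contracts G θ) (hT : μ.TranslateBound G)
    (H : AddSubgroup G) : PolyGrowth (μ.genWeight H) := by
  induction H using WellFoundedLT.induction with
  | _ H ih =>
    have hpoly : ∀ K < H, PolyBound μ K := by
      intro K hK
      have : PolyGrowth fun n => ∑ K' with K' ≤ K, μ.genWeight K' n :=
        PolyGrowth.sum fun K' hK' => ih K' (lt_of_le_of_lt (by simpa using hK') hK)
      simp_rw [← step_pow_nil_eq_sum_genWeight] at this
      exact this
    obtain ⟨C, r, hC, -, -, -, -, hb⟩ := hθ.mixes_of_polyBound hT H hpoly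
    by_cases hH : H = ⊥
    · subst hH
      exact (PolyGrowth.const 1).mono fun n => (genWeight_bot n).le
    have hgrow : PolyGrowth fun n => ∑ k ∈ Finset.range n, ∑ H' with H' < H,
        Fintype.card G * C * μ.genWeight H' k :=
      PolyGrowth.sum_range (PolyGrowth.sum fun H' hH' =>
        (ih H' (by simpa using hH')).const_mul (by positivity))
    refine hgrow.mono fun n => ?_
    rw [genWeight, step_top_pow_genInd_eq, genInd_nil_of_ne_bot hH, zero_add]
    refine Finset.sum_le_sum fun k _ => Finset.sum_le_sum fun H' _ => ?_
    exact step_pow_genInd_le (fun u _ => step_top_genInd_le hC (fun v hv => hb v hv _) u) k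

theorem Contracts.mixes (hθ : μ.Contracts G θ) (hT : μ.TranslateBound G) (H : AddSubgroup G) :
    Mixes μ θ H := by
  refine hθ.mixes_of_polyBound hT H fun K _ => ?_
  have : PolyGrowth fun n => ∑ K' with K' ≤ K, μ.genWeight K' n :=
    PolyGrowth.sum fun K' _ => hθ.polyGrowth_genWeight hT K'
  simp_rw [← step_pow_nil_eq_sum_genWeight] at this
  exact this

end CoeffLaw

/-! ### Jumps of index `p`, compared with the problem over `ZMod p`. -/

namespace CoeffLaw

variable {ι : Type} [Fintype ι] {μ : CoeffLaw ι}
variable {G : Type*} [AddCommGroup G] [Fintype G] {θ : ℝ}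

/-- For `H'` of index `p` in `H`, a homomorphism `H → ZMod p` with kernel `H'`. -/
lemma exists_hom_of_card_eq {p : ℕ} [Fact p.Prime] {H H' : AddSubgroup G} (hle : H' ≤ H)
    (hcard : Nat.card H = p * Nat.card H') :
    ∃ π : H →+ ZMod p, Function.Surjective π ∧ ∀ x : H, π x = 0 ↔ (x : G) ∈ H' := by
  set K := H'.addSubgroupOf H with hK
  have hc : Nat.card (H ⧸ K) = p := by
    have h1 := AddSubgroup.card_eq_card_quotient_mul_card_addSubgroup K
    have h2 : Nat.card K = Nat.card H' :=
      Nat.card_congr (AddSubgroup.addSubgroupOfEquivOfLe hle).toEquiv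
    rw [h2, hcard] at h1
    exact (Nat.eq_of_mul_eq_mul_right Nat.card_pos h1).symm
  let e : H ⧸ K ≃+ ZMod p := addEquivOfPrimeCardEq (p := p) hc (by simp)
  refine ⟨e.toAddMonoidHom.comp (QuotientAddGroup.mk' K), ?_, fun x => ?_⟩
  · exact e.surjective.comp (QuotientAddGroup.mk'_surjective K)
  · simp [hK, AddSubgroup.mem_addSubgroupOf]

section Compare

variable {p : ℕ} [Fact p.Prime] {H H' : AddSubgroup G} {π : H →+ ZMod p}

lemma sum_comp_hom (hsurj : Function.Surjective π) (hker : ∀ x : H, π x = 0 ↔ (x : G) ∈ H')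
    (hle : H' ≤ H) (f : ZMod p → ℝ) :
    ∑ x : H, f (π x) = Nat.card H' * ∑ y, f y := by
  rw [← Finset.sum_fiberwise (s := Finset.univ) (g := π), Finset.mul_sum]
  refine Finset.sum_congr rfl fun y _ => ?_
  have hc : (Finset.univ.filter fun x : H => π x = y).card = Nat.card H' := by
    rw [AddMonoidHom.card_fiber_eq_of_mem_range π (hsurj y) (hsurj 0), Nat.card_eq_fintype_card,
      ← Fintype.card_subtype]
    refine Fintype.card_congr
      ⟨fun x => ⟨x.1, (hker _).1 x.2⟩, fun x => ⟨⟨x.1, hle x.2⟩, (hker _).2 x.2⟩, ?_, ?_⟩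
    · intro x; rfl
    · intro x; rfl
  rw [← hc, Finset.card_eq_sum_ones, Nat.cast_sum, Finset.sum_mul]
  refine Finset.sum_congr rfl fun x hx => ?_
  rw [(Finset.mem_filter.1 hx).2]; simp

lemma sum_sumLaw_mem (hker : ∀ x : H, π x = 0 ↔ (x : G) ∈ H') (z : List H) :
    ∑ g with g ∈ H', μ.sumLaw (z.map (↑)) g = μ.sumLaw (z.map π) 0 := by
  have h1 : ∀ g : G, μ.sumLaw (z.map (↑)) g = ∑ a ∈ Finset.univ.filter (fun a : H => (a : G) = g), μ.sumLaw z a :=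
    fun g => μ.sumLaw_map H.subtype z g
  simp_rw [h1]
  have h2 := Finset.sum_fiberwise_eq_sum_filter Finset.univ (Finset.univ.filter (· ∈ H'))
    (fun a : H => (a : G)) (fun a => μ.sumLaw z a)
  rw [sumLaw_map]
  refine (Eq.trans (by congr!) h2).trans (Finset.sum_congr ?_ fun _ _ => rfl)
  ext a
  simp [hker]

/-- The part of the row from `u` is nearly uniform on `H'`. So the part from `z` must fall in `H'`,
that is, vanish under `π`, and is then cancelled with probability about `1/|H'|`. -/
lemma Contracts.abs_sumLaw_append_sub_le (hθ : μ.Contracts G θ)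
    (hker : ∀ x : H, π x = 0 ↔ (x : G) ∈ H') {u : List G} (hu : gen u = H') (z : List H) :
    |μ.sumLaw (z.map (↑) ++ u) 0 - (Nat.card H' : ℝ)⁻¹ * μ.sumLaw (z.map π) 0| ≤
      mixErr θ H' u := by
  have h1 : μ.sumLaw (z.map (↑) ++ u) 0 - (Nat.card H' : ℝ)⁻¹ * μ.sumLaw (z.map π) 0 =
      ∑ g : G, μ.sumLaw (z.map (↑)) g *
        (μ.sumLaw u (0 - g) - if g ∈ H' then (Nat.card H' : ℝ)⁻¹ else 0) := by
    rw [sumLaw_append, ← sum_sumLaw_mem hker z, Finset.sum_filter, Finset.mul_sum,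
      ← Finset.sum_sub_distrib]
    refine Finset.sum_congr rfl fun g _ => ?_
    split_ifs <;> ring
  rw [h1]
  refine (Finset.abs_sum_le_sum_abs _ _).trans ?_
  rw [← one_mul (mixErr θ H' u), ← μ.sum_sumLaw (z.map (↑) : List G), Finset.sum_mul]
  refine Finset.sum_le_sum fun g _ => ?_
  rw [abs_mul, abs_of_nonneg (μ.sumLaw_nonneg _ _)]
  refine mul_le_mul_of_nonneg_left ?_ (μ.sumLaw_nonneg _ _)
  split_ifs with hg
  · exact hθ.abs_sumLaw_sub_le H' u (fun x hx => hu ▸ mem_gen hx) _ (H'.sub_mem H'.zero_mem hg)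
  · rw [μ.sumLaw_eq_zero_of_notMem H' u (fun x hx => hu ▸ mem_gen hx)]
    · simpa using mixErr_nonneg hθ.pos H' u
    · simpa using hg

lemma abs_mul_sub_mul_le {a b c d F D : ℝ} (h1 : |a - c| ≤ F) (hb : |b| ≤ D) {E : ℝ}
    (h2 : |b - d| ≤ E) (hc : |c| ≤ 1) : |a * b - c * d| ≤ F * D + E := by
  have : a * b - c * d = (a - c) * b + c * (b - d) := by ring
  rw [this]
  refine (abs_add_le _ _).trans (add_le_add ?_ ?_)
  · rw [abs_mul]; exact mul_le_mul h1 hb (abs_nonneg _) ((abs_nonneg _).trans h1)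
  · rw [abs_mul]
    exact (mul_le_of_le_one_left (abs_nonneg _) hc).trans h2

lemma abs_inv_mul_sumLaw_le (z : List (ZMod p)) :
    |(Nat.card H' : ℝ)⁻¹ * μ.sumLaw z 0| ≤ 1 := by
  have := μ.sumLaw_nonneg z 0
  rw [abs_of_nonneg (by positivity)]
  exact mul_le_one₀ (inv_le_one_of_one_le₀ (by exact_mod_cast Nat.card_pos)) this
    (μ.sumLaw_le_one z 0)

lemma abs_step_pow_one_le (K : AddSubgroup G) (m : ℕ) (u : List G) :
    |(μ.step K ^ m) 1 u| ≤ (Fintype.card G : ℝ) ^ m := by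
  rw [abs_of_nonneg (μ.step_pow_nonneg (f := 1) (fun _ => zero_le_one) m u)]
  simpa using μ.step_pow_le_card_pow (H := K) (f := 1) (fun _ => zero_le_one) (fun _ _ => le_rfl) m u

/-- Each residue in `ZMod p` has `|H'|` lifts to `H`, which cancels the factor `1/|H'|` per row. The
constant `c` grows with `m`, so this serves only for bounded `m`. -/
lemma Contracts.exists_abs_step_pow_sub_le (hθ : μ.Contracts G θ)
    (hsurj : Function.Surjective π) (hker : ∀ x : H, π x = 0 ↔ (x : G) ∈ H') (hle : H' ≤ H)
    (m : ℕ) : ∃ c : ℝ, 0 ≤ c ∧ ∀ (u : List G), gen u = H' → ∀ z : List H,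
      |(μ.step H ^ m) 1 (z.map (↑) ++ u) - (μ.step ⊤ ^ m) 1 (z.map π)| ≤ c * mixErr θ H' u := by
  induction m with
  | zero => exact ⟨0, le_rfl, fun u _ z => by simp⟩
  | succ m ih =>
    obtain ⟨c, hc, ih⟩ := ih
    refine ⟨Fintype.card H * ((Fintype.card G : ℝ) ^ m + c), by positivity, fun u hu z => ?_⟩
    have hH' : (Nat.card H' : ℝ) ≠ 0 := by exact_mod_cast Nat.card_pos.ne'
    have h1 : (μ.step H ^ (m + 1)) 1 (z.map (↑) ++ u) = ∑ x : H,
        μ.sumLaw ((x :: z).map (↑) ++ u) 0 * (μ.step H ^ m) 1 ((x :: z).map (↑) ++ u) := by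
      rw [step_pow_succ, Finset.sum_subtype (p := (· ∈ H)) _ (by simp)]
      rfl
    have h2 : (μ.step ⊤ ^ (m + 1)) 1 (z.map π) = ∑ x : H, ((Nat.card H' : ℝ)⁻¹ *
        μ.sumLaw ((x :: z).map π) 0) * (μ.step ⊤ ^ m) 1 ((x :: z).map π) := by
      have := sum_comp_hom hsurj hker hle
        (fun y => ((Nat.card H' : ℝ)⁻¹ * μ.sumLaw (y :: z.map π) 0) *
          (μ.step ⊤ ^ m) 1 (y :: z.map π))
      simp only [List.map_cons]
      rw [this, step_pow_succ, Finset.mul_sum]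
      simp only [AddSubgroup.mem_top, Finset.filter_true]
      refine Finset.sum_congr rfl fun y _ => ?_
      field_simp
    rw [h1, h2, ← Finset.sum_sub_distrib]
    refine (Finset.abs_sum_le_sum_abs _ _).trans ?_
    have h3 : ∀ x : H, |μ.sumLaw ((x :: z).map (↑) ++ u) 0 *
        (μ.step H ^ m) 1 ((x :: z).map (↑) ++ u) - ((Nat.card H' : ℝ)⁻¹ *
        μ.sumLaw ((x :: z).map π) 0) * (μ.step ⊤ ^ m) 1 ((x :: z).map π)| ≤
        mixErr θ H' u * (Fintype.card G : ℝ) ^ m + c * mixErr θ H' u := fun x =>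
      abs_mul_sub_mul_le (hθ.abs_sumLaw_append_sub_le hker hu _) (abs_step_pow_one_le _ _ _)
        (ih u hu _) (abs_inv_mul_sumLaw_le _)
    refine (Finset.sum_le_card_nsmul _ _ _ fun x _ => h3 x).trans (le_of_eq ?_)
    rw [nsmul_eq_mul, Finset.card_univ]; ring

variable (μ p) in
/-- The expected number of solutions in `ZMod p` in dimension `m + 1` whose first coordinate is
nonzero. -/
noncomputable def firstNeZeroWeight (m : ℕ) : ℝ :=
  ∑ y : ZMod p with y ≠ 0, μ.sumLaw [y] 0 * (μ.step ⊤ ^ m) 1 [y]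

lemma gen_cons_eq_of_card_eq (hle : H' ≤ H) (hcard : Nat.card H = p * Nat.card H') {u : List G}
    (hu : gen u = H') {x : G} (hx : x ∈ H) (hx' : x ∉ H') : gen (x :: u) = H := by
  have h1 : gen (x :: u) ≤ H := gen_cons_le.2 ⟨hx, hu ▸ hle⟩
  have h2 : H' ≤ gen (x :: u) := hu ▸ gen_le_cons x u
  obtain ⟨a, ha⟩ := AddSubgroup.card_dvd_of_le h2
  obtain ⟨b, hb⟩ := AddSubgroup.card_dvd_of_le h1
  have hH' : 0 < Nat.card H' := Nat.card_pos
  have hab : a * b = p := by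
    apply Nat.eq_of_mul_eq_mul_left hH'
    rw [← mul_assoc, ← ha, ← hb, hcard, mul_comm]
  rcases (Nat.dvd_prime (Fact.out : p.Prime)).1 (Dvd.intro _ hab) with rfl | rfl
  · rw [mul_one] at ha
    have := AddSubgroup.eq_of_le_of_card_ge h2 ha.le
    exact absurd (this ▸ mem_gen List.mem_cons_self) hx'
  · have hb1 : b = 1 := Nat.eq_of_mul_eq_mul_left (Nat.pos_of_ne_zero
      (Fact.out : Nat.Prime _).ne_zero) (by rw [hab, mul_one])
    rw [hb1, mul_one] at hb
    exact AddSubgroup.eq_of_le_of_card_ge h1 hb.le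

/-- By primality of the index, an entry jumps to `H` exactly when its image under `π` is nonzero,
which matches the condition on the first coordinate over `ZMod p`. -/
lemma Contracts.exists_abs_jump_sub_le (hθ : μ.Contracts G θ) (hle : H' ≤ H)
    (hcard : Nat.card H = p * Nat.card H') (m : ℕ) :
    ∃ c : ℝ, 0 ≤ c ∧ ∀ (u : List G), gen u = H' →
      |μ.step ⊤ (genInd H ((μ.step H ^ m) 1)) u - μ.firstNeZeroWeight p m| ≤
        c * mixErr θ H' u := by
  obtain ⟨π, hsurj, hker⟩ := exists_hom_of_card_eq hle hcard
  obtain ⟨c, hc, hm⟩ := hθ.exists_abs_step_pow_sub_le hsurj hker hle m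
  refine ⟨Fintype.card H * ((Fintype.card G : ℝ) ^ m + c), by positivity, fun u hu => ?_⟩
  have hH' : (Nat.card H' : ℝ) ≠ 0 := by exact_mod_cast Nat.card_pos.ne'
  have h1 : μ.step ⊤ (genInd H ((μ.step H ^ m) 1)) u = ∑ x : H, if π x = 0 then 0 else
      μ.sumLaw ([x].map (↑) ++ u) 0 * (μ.step H ^ m) 1 ([x].map (↑) ++ u) := by
    rw [step_apply]
    simp only [AddSubgroup.mem_top, Finset.filter_true]
    rw [← Finset.sum_filter_of_ne (p := (· ∈ H)), Finset.sum_subtype (p := (· ∈ H)) _ (by simp)]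
    · refine Finset.sum_congr rfl fun x _ => ?_
      by_cases hx : (x : G) ∈ H'
      · rw [if_pos ((hker x).2 hx), genInd_of_ne, mul_zero]
        rw [gen_cons_eq hu hx]
        rintro rfl
        have hp := (Fact.out : p.Prime).one_lt
        have : 0 < Nat.card H' := Nat.card_pos
        nlinarith
      · rw [if_neg (mt (hker x).1 hx), genInd_of_eq (gen_cons_eq_of_card_eq hle hcard hu x.2 hx)]
        rfl
    · intro x _ hx
      by_contra hxH
      refine hx ?_
      rw [genInd_of_ne, mul_zero]
      exact fun h => hxH (gen_cons_le.1 h.le).1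
  have h2 : μ.firstNeZeroWeight p m = ∑ x : H, if π x = 0 then 0 else
      ((Nat.card H' : ℝ)⁻¹ * μ.sumLaw ([x].map π) 0) * (μ.step ⊤ ^ m) 1 ([x].map π) := by
    have := sum_comp_hom hsurj hker hle (fun y => if y = 0 then 0 else
      ((Nat.card H' : ℝ)⁻¹ * μ.sumLaw [y] 0) * (μ.step ⊤ ^ m) 1 [y])
    simp only [List.map_cons, List.map_nil]
    rw [this, firstNeZeroWeight, Finset.sum_filter, Finset.mul_sum]
    refine Finset.sum_congr rfl fun y _ => ?_
    by_cases hy : y = 0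
    · simp [hy]
    · rw [if_pos hy, if_neg hy]; field_simp
  rw [h1, h2, ← Finset.sum_sub_distrib]
  refine (Finset.abs_sum_le_sum_abs _ _).trans ?_
  have hF := mixErr_nonneg hθ.pos H' u
  have h3 : ∀ x : H, |(if π x = 0 then 0 else
      μ.sumLaw ([x].map (↑) ++ u) 0 * (μ.step H ^ m) 1 ([x].map (↑) ++ u)) -
      (if π x = 0 then 0 else
      ((Nat.card H' : ℝ)⁻¹ * μ.sumLaw ([x].map π) 0) * (μ.step ⊤ ^ m) 1 ([x].map π))| ≤
      mixErr θ H' u * (Fintype.card G : ℝ) ^ m + c * mixErr θ H' u := by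
    intro x
    by_cases hx : π x = 0
    · rw [if_pos hx, if_pos hx, sub_zero, abs_zero]; positivity
    · rw [if_neg hx, if_neg hx]
      exact abs_mul_sub_mul_le (hθ.abs_sumLaw_append_sub_le hker hu _)
        (abs_step_pow_one_le _ _ _) (hm u hu _) (abs_inv_mul_sumLaw_le _)
  refine (Finset.sum_le_card_nsmul _ _ _ fun x _ => h3 x).trans (le_of_eq ?_)
  rw [nsmul_eq_mul, Finset.card_univ]; ring

/-- After a well-mixed history in `H'`, the weight of the excursions jumping to `H` is close to the
limit of `firstNeZeroWeight`. -/
lemma Contracts.exists_abs_jump_sub_lim_le (hθ : μ.Contracts G θ) (hmix : Mixes μ θ H)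
    (hle : H' ≤ H) (hcard : Nat.card H = p * Nat.card H') {χ : ℝ}
    (hχ : Tendsto (μ.firstNeZeroWeight p) atTop (𝓝 χ)) {ε : ℝ} (hε : 0 < ε) :
    ∃ (M : ℕ) (E : ℝ), ∀ m ≥ M, ∀ u, gen u = H' →
      |μ.step ⊤ (genInd H ((μ.step H ^ m) 1)) u - χ| ≤ ε + E * mixErr θ H' u := by
  obtain ⟨C, r, hC, hr0, hr1, -, hcau, -⟩ := hmix
  have h1 : ∀ᶠ M : ℕ in atTop, Fintype.card G * (C * r ^ M) ≤ ε / 2 := by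
    have := ((tendsto_pow_atTop_nhds_zero_of_lt_one hr0.le hr1).const_mul C).const_mul
      (Fintype.card G : ℝ)
    rw [mul_zero, mul_zero] at this
    exact (this.eventually_lt_const (show (0 : ℝ) < ε / 2 by linarith)).mono fun _ h => h.le
  have h2 : ∀ᶠ M : ℕ in atTop, |μ.firstNeZeroWeight p M - χ| ≤ ε / 2 := by
    have := hχ.sub_const χ
    rw [sub_self] at this
    have := this.abs
    rw [abs_zero] at this
    exact (this.eventually_lt_const (show (0 : ℝ) < ε / 2 by linarith)).mono fun _ h => h.le
  obtain ⟨M, hM1, hM2⟩ := (h1.and h2).exists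
  obtain ⟨c, -, hc⟩ := hθ.exists_abs_jump_sub_le hle hcard M
  refine ⟨M, c, fun m hm u hu => ?_⟩
  obtain ⟨k, rfl⟩ := Nat.exists_eq_add_of_le hm
  -- The comparison is made at the fixed time `M`; mixing on `H` makes the change from `M` to `M +
  -- k` small uniformly in `k`.
  have h3 : |μ.step ⊤ (genInd H ((μ.step H ^ (M + k)) 1)) u -
      μ.step ⊤ (genInd H ((μ.step H ^ M) 1)) u| ≤ ε / 2 := by
    refine le_trans ?_ hM1
    rw [step_apply, step_apply, ← Finset.sum_sub_distrib]
    refine (Finset.abs_sum_le_sum_abs _ _).trans ?_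
    have h4 : ∀ x : G, |μ.sumLaw (x :: u) 0 * genInd H ((μ.step H ^ (M + k)) 1) (x :: u) -
        μ.sumLaw (x :: u) 0 * genInd H ((μ.step H ^ M) 1) (x :: u)| ≤ C * r ^ M := by
      intro x
      rw [← mul_sub, abs_mul, abs_of_nonneg (μ.sumLaw_nonneg _ _)]
      refine (mul_le_of_le_one_left (abs_nonneg _) (μ.sumLaw_le_one _ _)).trans ?_
      by_cases h : gen (x :: u) = H
      · rw [genInd_of_eq h, genInd_of_eq h]; exact hcau _ h M k
      · rw [genInd_of_ne h, genInd_of_ne h, sub_zero, abs_zero]; positivity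
    refine (Finset.sum_le_sum fun x _ => h4 x).trans (le_of_eq ?_)
    simp
  have h5 := hc u hu
  have h6 := abs_sub_le (μ.step ⊤ (genInd H ((μ.step H ^ (M + k)) 1)) u)
    (μ.step ⊤ (genInd H ((μ.step H ^ M) 1)) u) χ
  have h7 := abs_sub_le (μ.step ⊤ (genInd H ((μ.step H ^ M) 1)) u) (μ.firstNeZeroWeight p M) χ
  linarith

end Compare

end CoeffLaw

/-! ### Existence and positivity of the constant `χ₀`. -/

namespace CoeffLaw

section Limit

variable {ι : Type} [Fintype ι] {μ : CoeffLaw ι} {p : ℕ} [Fact p.Prime] {θ : ℝ}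

lemma gen_eq_top_of_ne_zero {y : ZMod p} (hy : y ≠ 0) {u : List (ZMod p)} (hu : y ∈ u) :
    gen u = ⊤ := by
  have : IsSimpleAddGroup (ZMod p) := isSimpleAddGroup_of_prime_card (p := p) (by simp)
  rcases (IsSimpleAddGroup.eq_bot_or_eq_top_of_normal (gen u) inferInstance) with h | h
  · exact absurd (by simpa [h] using mem_gen hu) hy
  · exact h

/-- A single nonzero entry generates `ZMod p`, so the Cauchy estimate from mixing applies from the
first coordinate on. -/
lemma Contracts.exists_tendsto_firstNeZeroWeight (hmix : Mixes μ θ (⊤ : AddSubgroup (ZMod p))) :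
    ∃ χ : ℝ, Tendsto (μ.firstNeZeroWeight p) atTop (𝓝 χ) := by
  obtain ⟨C, r, hC, hr0, hr1, -, hcau, -⟩ := hmix
  have h1 : ∀ m k, |μ.firstNeZeroWeight p (m + k) - μ.firstNeZeroWeight p m| ≤
      Fintype.card (ZMod p) * C * r ^ m := by
    intro m k
    rw [firstNeZeroWeight, firstNeZeroWeight, ← Finset.sum_sub_distrib]
    refine (Finset.abs_sum_le_sum_abs _ _).trans ?_
    have h2 : ∀ y ∈ Finset.univ.filter (fun y : ZMod p => y ≠ 0),
        |μ.sumLaw [y] 0 * (μ.step ⊤ ^ (m + k)) 1 [y] - μ.sumLaw [y] 0 * (μ.step ⊤ ^ m) 1 [y]| ≤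
          C * r ^ m := by
      intro y hy
      rw [← mul_sub, abs_mul, abs_of_nonneg (μ.sumLaw_nonneg _ _)]
      refine (mul_le_of_le_one_left (abs_nonneg _) (μ.sumLaw_le_one _ _)).trans ?_
      exact hcau _ (gen_eq_top_of_ne_zero (by simpa using hy) List.mem_cons_self) m k
    refine (Finset.sum_le_card_nsmul _ _ _ h2).trans ?_
    rw [nsmul_eq_mul, mul_assoc]
    refine mul_le_mul_of_nonneg_right ?_ (by positivity)
    exact_mod_cast Finset.card_le_univ _
  have hcs : CauchySeq (μ.firstNeZeroWeight p) := by
    refine cauchySeq_of_le_tendsto_0 (fun N => 2 * (Fintype.card (ZMod p) * C * r ^ N))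
      (fun n m N hn hm => ?_) ?_
    · obtain ⟨a, rfl⟩ := Nat.exists_eq_add_of_le hn
      obtain ⟨b, rfl⟩ := Nat.exists_eq_add_of_le hm
      rw [Real.dist_eq]
      have h3 := h1 N a
      have h4 := h1 N b
      have h5 := abs_sub_le (μ.firstNeZeroWeight p (N + a)) (μ.firstNeZeroWeight p N)
        (μ.firstNeZeroWeight p (N + b))
      rw [abs_sub_comm (μ.firstNeZeroWeight p N)] at h5
      linarith
    · have := ((tendsto_pow_atTop_nhds_zero_of_lt_one hr0.le hr1).const_mul
        (Fintype.card (ZMod p) * C)).const_mul 2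
      simpa using this
  exact cauchySeq_tendsto_of_complete hcs

/-- Appending further ones costs only a positive factor: all coefficients in a row may equal one
integer divisible by `p`. -/
lemma exists_le_step_pow_replicate {a : ι} (ha : 0 < μ.weight a) (hpa : (p : ℤ) ∣ μ.coeff a)
    (i j : ℕ) : ∃ c : ℝ, 0 < c ∧ ∀ m, c * (μ.step ⊤ ^ m) 1 (List.replicate (i + j) (1 : ZMod p)) ≤
      (μ.step ⊤ ^ (m + j)) 1 (List.replicate i (1 : ZMod p)) := by
  induction j generalizing i with
  | zero => exact ⟨1, one_pos, fun m => by simp⟩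
  | succ j ih =>
    obtain ⟨c, hc, h⟩ := ih (i + 1)
    have hq : 0 < μ.sumLaw ((1 : ZMod p) :: List.replicate i 1) 0 := by
      refine lt_of_lt_of_le (pow_pos ha _) (μ.pow_length_le_sumLaw a _ fun x _ => ?_)
      rw [zsmul_eq_mul, (ZMod.intCast_zmod_eq_zero_iff_dvd _ p).2 hpa, zero_mul]
    refine ⟨μ.sumLaw ((1 : ZMod p) :: List.replicate i 1) 0 * c, mul_pos hq hc, fun m => ?_⟩
    rw [← add_assoc m, step_pow_succ]
    refine le_trans ?_ (Finset.single_le_sum (f := fun x : ZMod p =>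
      μ.sumLaw (x :: List.replicate i 1) 0 * (μ.step ⊤ ^ (m + j)) 1 (x :: List.replicate i 1))
      (fun x _ => mul_nonneg (μ.sumLaw_nonneg _ _)
        (μ.step_pow_nonneg (f := 1) (fun _ => zero_le_one) _ _)) (a := 1) (by simp))
    rw [mul_assoc]
    refine mul_le_mul_of_nonneg_left ?_ hq.le
    have := h m
    rwa [show i + 1 + j = i + (j + 1) by ring] at this

/-- Begin with so many ones that `mixErr` is small enough for the total later loss of weight to be
at most `1/2`. This beginning has positive weight, and that bound holds for all times. -/
lemma Contracts.limit_pos (hθ : μ.Contracts (ZMod p) θ) {a : ι} (ha : 0 < μ.weight a)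
    (hpa : (p : ℤ) ∣ μ.coeff a) {χ : ℝ} (hχ : Tendsto (μ.firstNeZeroWeight p) atTop (𝓝 χ)) :
    0 < χ := by
  have h0 := hθ.pos
  have h1 := hθ.lt_one
  obtain ⟨ε, r, hε, hr0, hr1, hcontr⟩ := hθ.exists_contraction ⊤
  have hr : 0 < 1 - r := by linarith
  set g : ℝ := (Fintype.card (ZMod p) : ℝ) with hg
  have hg0 : 0 ≤ g := by positivity
  set N : ℝ := ((nontrivChars (⊤ : AddSubgroup (ZMod p))).card : ℝ) with hN
  have hlim := (tendsto_pow_atTop_nhds_zero_of_lt_one h0.le h1).comp (tendsto_add_atTop_nat 1)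
  have e1 : ∀ᶠ k in atTop, N * θ ^ (k + 1) ≤ ε := by
    have := hlim.const_mul N
    rw [mul_zero] at this
    exact (this.eventually_lt_const hε).mono fun _ h => h.le
  have e2 : ∀ᶠ k in atTop, g / (1 - r) * (N * θ ^ (k + 1)) ≤ 1 / 2 := by
    have := (hlim.const_mul N).const_mul (g / (1 - r))
    rw [mul_zero, mul_zero] at this
    exact (this.eventually_lt_const (show (0 : ℝ) < 1 / 2 by norm_num)).mono fun _ h => h.le
  obtain ⟨k, hk1, hk2⟩ := (e1.and e2).exists
  set u := List.replicate (1 + k) (1 : ZMod p) with hu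
  have hgen : gen u = ⊤ := gen_eq_top_of_ne_zero one_ne_zero (by simp [hu])
  have hF : mixErr θ ⊤ u = N * θ ^ (k + 1) := by
    rw [mixErr, Finset.sum_congr rfl (g := fun _ => θ ^ (k + 1)), Finset.sum_const, nsmul_eq_mul]
    intro ψ hψ
    obtain ⟨x, hx, hx1⟩ := exists_mem_of_mem_nontrivChars hψ hgen
    rw [List.eq_of_mem_replicate hx] at hx1
    rw [charErr, hu, List.map_replicate, if_neg hx1, List.prod_replicate, add_comm]
  have hhalf : ∀ m, 1 / 2 ≤ (μ.step ⊤ ^ m) 1 u := by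
    intro m
    have := abs_sub_le_of_geometric (f := fun m => (μ.step ⊤ ^ m) 1 u) (C := g * (N * θ ^ (k + 1)))
      hr0 hr1 (fun m => by
        refine (hθ.abs_step_pow_succ_sub_le le_top m).trans ?_
        rw [mul_assoc]
        refine mul_le_mul_of_nonneg_left ?_ hg0
        have := hcontr u le_top (hF ▸ hk1) m
        rwa [hF, mul_comm] at this) 0 m
    simp only [zero_add, pow_zero, Module.End.one_apply, Pi.one_apply, mul_one] at this
    rw [mul_div_right_comm] at this
    have := (abs_le.1 (this.trans hk2)).1
    linarith
  obtain ⟨c, hc, hcm⟩ := exists_le_step_pow_replicate ha hpa 1 k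
  have hq : 0 < μ.sumLaw [(1 : ZMod p)] 0 := by
    refine lt_of_lt_of_le (pow_pos ha _) (μ.pow_length_le_sumLaw a _ fun x _ => ?_)
    rw [zsmul_eq_mul, (ZMod.intCast_zmod_eq_zero_iff_dvd _ p).2 hpa, zero_mul]
  refine lt_of_lt_of_le (show 0 < μ.sumLaw [(1 : ZMod p)] 0 * (c * (1 / 2)) by positivity)
    (ge_of_tendsto hχ ?_)
  filter_upwards [eventually_ge_atTop k] with n hn
  obtain ⟨m, rfl⟩ := Nat.exists_eq_add_of_le' hn
  refine le_trans ?_ (Finset.single_le_sum (f := fun y : ZMod p =>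
      μ.sumLaw [y] 0 * (μ.step ⊤ ^ (m + k)) 1 [y])
      (fun x _ => mul_nonneg (μ.sumLaw_nonneg _ _)
        (μ.step_pow_nonneg (f := 1) (fun _ => zero_le_one) _ _)) (a := 1) (by simp))
  exact mul_le_mul_of_nonneg_left
    ((mul_le_mul_of_nonneg_left (hhalf m) hc.le).trans (hcm m)) hq.le

end Limit

end CoeffLaw

/-! ### Averages of polynomially growing sequences -/

lemma exists_le_mul_add_one_pow {b : ℕ → ℝ} {l : ℕ} {c : ℝ}
    (hb : Tendsto (fun n => b n / (n : ℝ) ^ l) atTop (𝓝 c)) :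
    ∃ B : ℝ, 0 ≤ B ∧ ∀ k : ℕ, b k ≤ B * ((k : ℝ) + 1) ^ l := by
  obtain ⟨B, hB⟩ := hb.bddAbove_range
  -- The extra `|b 0|` is for `k = 0`, where the quotient by `0 ^ l` carries no information when `l
  -- > 0`.
  refine ⟨|B| + |b 0|, by positivity, fun k => ?_⟩
  rcases Nat.eq_zero_or_pos k with rfl | hk
  · simp only [Nat.cast_zero, zero_add, one_pow, mul_one]
    linarith [le_abs_self (b 0), abs_nonneg B]
  · have hk' : (0 : ℝ) < (k : ℝ) ^ l := by positivity
    have h1 := (div_le_iff₀ hk').1 (hB ⟨k, rfl⟩)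
    have h2 : (k : ℝ) ^ l ≤ ((k : ℝ) + 1) ^ l := pow_le_pow_left₀ (by positivity) (by linarith) l
    calc b k ≤ |B| * (k : ℝ) ^ l := h1.trans (mul_le_mul_of_nonneg_right (le_abs_self B) hk'.le)
      _ ≤ |B| * ((k : ℝ) + 1) ^ l := mul_le_mul_of_nonneg_left h2 (abs_nonneg B)
      _ ≤ _ := mul_le_mul_of_nonneg_right (by linarith [abs_nonneg (b 0)]) (by positivity)

lemma tendsto_sum_div_pow_of_zero {b : ℕ → ℝ} {l : ℕ}
    (hb : Tendsto (fun n => b n / (n : ℝ) ^ l) atTop (𝓝 0)) :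
    Tendsto (fun n => (∑ k ∈ Finset.range n, b k) / (n : ℝ) ^ (l + 1)) atTop (𝓝 0) := by
  have h1 : b =o[atTop] fun n : ℕ => (n : ℝ) ^ l := by
    refine (Asymptotics.isLittleO_iff_tendsto' ?_).2 hb
    filter_upwards [eventually_gt_atTop 0] with n hn h
    exact absurd h (by positivity)
  have h2 : (fun n : ℕ => (n : ℝ) ^ l) =O[atTop] fun n : ℕ => ((n : ℝ) + 1) ^ l := by
    refine Asymptotics.IsBigO.of_bound 1 (Eventually.of_forall fun n => ?_)
    rw [one_mul, Real.norm_of_nonneg (by positivity), Real.norm_of_nonneg (by positivity)]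
    exact pow_le_pow_left₀ (by positivity) (by linarith) l
  have h3 := (h1.trans_isBigO h2).sum_range (fun n => by positivity) (by
    refine tendsto_atTop_mono (fun n => ?_) (tendsto_natCast_atTop_atTop (R := ℝ))
    calc (n : ℝ) = ∑ k ∈ Finset.range n, (1 : ℝ) := by simp
      _ ≤ _ := Finset.sum_le_sum fun k _ => one_le_pow₀ (by linarith [k.cast_nonneg (α := ℝ)]))
  have h4 : (fun n : ℕ => ∑ k ∈ Finset.range n, ((k : ℝ) + 1) ^ l) =O[atTop]
      fun n : ℕ => (n : ℝ) ^ (l + 1) := by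
    refine Asymptotics.IsBigO.of_bound 1 (Eventually.of_forall fun n => ?_)
    rw [one_mul, Real.norm_of_nonneg (Finset.sum_nonneg fun k _ => by positivity),
      Real.norm_of_nonneg (by positivity)]
    calc _ ≤ ∑ k ∈ Finset.range n, (n : ℝ) ^ l := by
          refine Finset.sum_le_sum fun k hk => pow_le_pow_left₀ (by positivity) ?_ l
          exact_mod_cast Nat.succ_le_of_lt (Finset.mem_range.1 hk)
      _ = _ := by simp [pow_succ, mul_comm]
  exact (h3.trans_isBigO h4).tendsto_div_nhds_zero

/-- After rescaling this is the difference quotient of `x ^ (l + 1)` at `1` with increment `1/n`. -/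
lemma tendsto_succ_pow_sub_pow_div (l : ℕ) :
    Tendsto (fun n : ℕ => (((n : ℝ) + 1) ^ (l + 1) - (n : ℝ) ^ (l + 1)) / (n : ℝ) ^ l) atTop
      (𝓝 (l + 1)) := by
  have h : HasDerivAt (fun x : ℝ => x ^ (l + 1)) (l + 1) 1 := by
    simpa using hasDerivAt_pow (l + 1) (1 : ℝ)
  have h1 := (hasDerivAt_iff_tendsto_slope_zero.1 h).comp
    (tendsto_nhdsWithin_of_tendsto_nhds_of_eventually_within _
      (tendsto_inv_atTop_nhds_zero_nat (𝕜 := ℝ))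
      (by filter_upwards [eventually_gt_atTop 0] with n hn; simp; omega))
  refine h1.congr' ?_
  filter_upwards [eventually_gt_atTop 0] with n hn
  have : (n : ℝ) ≠ 0 := by positivity
  simp only [Function.comp_apply, inv_inv, smul_eq_mul, one_pow]
  rw [eq_div_iff (by positivity)]
  have h2 : (1 + (n : ℝ)⁻¹) = ((n : ℝ) + 1) / n := by field_simp
  rw [h2, div_pow]
  field_simp
  ring

/-- Subtracting a multiple of the increments of `k ^ (l + 1)`, whose sum telescopes, reduces to
limit zero. -/
lemma tendsto_sum_div_pow {b : ℕ → ℝ} {l : ℕ} {c : ℝ}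
    (hb : Tendsto (fun n => b n / (n : ℝ) ^ l) atTop (𝓝 c)) :
    Tendsto (fun n => (∑ k ∈ Finset.range n, b k) / (n : ℝ) ^ (l + 1)) atTop
      (𝓝 (c / (l + 1))) := by
  have hl : (l : ℝ) + 1 ≠ 0 := by positivity
  have h1 : Tendsto (fun n : ℕ => (b n - c / (l + 1) * (((n : ℝ) + 1) ^ (l + 1) -
      (n : ℝ) ^ (l + 1))) / (n : ℝ) ^ l) atTop (𝓝 0) := by
    have := hb.sub ((tendsto_succ_pow_sub_pow_div l).const_mul (c / (l + 1)))
    rw [div_mul_cancel₀ _ hl, sub_self] at this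
    refine this.congr fun n => ?_
    ring
  have h2 := (tendsto_sum_div_pow_of_zero h1).add_const (c / (l + 1))
  rw [zero_add] at h2
  refine h2.congr' ?_
  filter_upwards [eventually_gt_atTop 0] with n hn
  have hn' : (n : ℝ) ^ (l + 1) ≠ 0 := by positivity
  have h3 := Finset.sum_range_sub (fun k : ℕ => (k : ℝ) ^ (l + 1)) n
  push_cast at h3
  rw [Finset.sum_sub_distrib, ← Finset.mul_sum, h3]
  field_simp
  simp

/-- A Cesàro limit of terms `t k (n - 1 - k)` that are asymptotically `χ * b k`. -/
lemma tendsto_sum_conv {b e : ℕ → ℝ} {t : ℕ → ℕ → ℝ} {l : ℕ} {c χ D : ℝ}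
    (hb0 : ∀ k, 0 ≤ b k) (he0 : ∀ k, 0 ≤ e k)
    (hb : Tendsto (fun n => b n / (n : ℝ) ^ l) atTop (𝓝 c))
    (he : Tendsto (fun n => e n / (n : ℝ) ^ l) atTop (𝓝 0))
    (htD : ∀ k m, |t k m| ≤ D * b k)
    (ht : ∀ ε > 0, ∃ (M : ℕ) (E : ℝ), ∀ m ≥ M, ∀ k, |t k m - χ * b k| ≤ ε * b k + E * e k) :
    Tendsto (fun n => (∑ k ∈ Finset.range n, t k (n - 1 - k)) / (n : ℝ) ^ (l + 1)) atTop
      (𝓝 (χ * (c / (l + 1)))) := by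
  have hB := tendsto_sum_div_pow hb
  have hE := tendsto_sum_div_pow_of_zero he
  suffices h : Tendsto (fun n => (∑ k ∈ Finset.range n, (t k (n - 1 - k) - χ * b k)) /
      (n : ℝ) ^ (l + 1)) atTop (𝓝 0) by
    have := h.add (hB.const_mul χ)
    rw [zero_add] at this
    refine this.congr fun n => ?_
    rw [Finset.sum_sub_distrib, ← Finset.mul_sum]
    ring
  obtain ⟨B, hB0, hBk⟩ := exists_le_mul_add_one_pow hb
  have hc : 0 ≤ c / (l + 1) := ge_of_tendsto' hB fun n =>
    div_nonneg (Finset.sum_nonneg fun k _ => hb0 k) (by positivity)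
  rw [Metric.tendsto_atTop']
  intro η hη
  set ε := η / 2 / (c / (l + 1) + 1) with hε
  have hε0 : 0 < ε := by positivity
  obtain ⟨M, E, hM⟩ := ht ε hε0
  have hbound : ∀ n : ℕ, 0 < n →
      |(∑ k ∈ Finset.range n, (t k (n - 1 - k) - χ * b k)) / (n : ℝ) ^ (l + 1)| ≤
      ε * ((∑ k ∈ Finset.range n, b k) / (n : ℝ) ^ (l + 1)) +
      |E| * ((∑ k ∈ Finset.range n, e k) / (n : ℝ) ^ (l + 1)) +
      M * ((|D| + |χ|) * B) * (n : ℝ)⁻¹ := by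
    intro n hn
    have hn' : (0 : ℝ) < n := by exact_mod_cast hn
    rw [abs_div, abs_of_pos (show (0 : ℝ) < (n : ℝ) ^ (l + 1) by positivity),
      div_le_iff₀ (by positivity)]
    -- At most `M` indices have remaining time `n - 1 - k < M`. There only the crude bound holds,
    -- contributing `O(n ^ l)` in total, which is negligible against `n ^ (l + 1)`.
    have hterm : ∀ k ∈ Finset.range n, |t k (n - 1 - k) - χ * b k| ≤ ε * b k + |E| * e k +
        if n - 1 - k < M then (|D| + |χ|) * (B * (n : ℝ) ^ l) else 0 := by
      intro k hk
      have hk' : ((k : ℝ) + 1) ≤ n := by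
        exact_mod_cast Nat.succ_le_of_lt (Finset.mem_range.1 hk)
      have hEe : 0 ≤ |E| * e k := mul_nonneg (abs_nonneg E) (he0 k)
      have hεb : 0 ≤ ε * b k := mul_nonneg hε0.le (hb0 k)
      split_ifs with h
      · have h1 : |t k (n - 1 - k) - χ * b k| ≤ (|D| + |χ|) * b k := by
          refine (abs_sub _ _).trans ?_
          rw [add_mul, abs_mul, abs_of_nonneg (hb0 k)]
          exact add_le_add ((htD _ _).trans (mul_le_mul_of_nonneg_right (le_abs_self D) (hb0 k)))
            le_rfl
        have h2 : b k ≤ B * (n : ℝ) ^ l := (hBk k).trans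
          (mul_le_mul_of_nonneg_left (pow_le_pow_left₀ (by positivity) hk' l) hB0)
        have h3 := mul_le_mul_of_nonneg_left h2 (show 0 ≤ |D| + |χ| by positivity)
        linarith
      · have h1 := hM (n - 1 - k) (not_lt.1 h) k
        have h2 := mul_le_mul_of_nonneg_right (le_abs_self E) (he0 k)
        linarith
    refine (Finset.abs_sum_le_sum_abs _ _).trans ((Finset.sum_le_sum hterm).trans ?_)
    rw [Finset.sum_add_distrib, Finset.sum_add_distrib, ← Finset.mul_sum, ← Finset.mul_sum,
      ← Finset.sum_filter, Finset.sum_const, nsmul_eq_mul]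
    have hcard : ((Finset.range n).filter fun k => n - 1 - k < M).card ≤ M := by
      refine (Finset.card_le_card_of_injOn (t := Finset.range M) (fun k => n - 1 - k) ?_ ?_).trans
        (by simp)
      · intro k hk; simp at hk ⊢; exact hk.2
      · intro k hk k' hk' h
        simp at hk hk' h
        omega
    have h5 : (((Finset.range n).filter fun k => n - 1 - k < M).card : ℝ) *
        ((|D| + |χ|) * (B * (n : ℝ) ^ l)) ≤ M * ((|D| + |χ|) * (B * (n : ℝ) ^ l)) :=
      mul_le_mul_of_nonneg_right (by exact_mod_cast hcard) (by positivity)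
    refine (add_le_add le_rfl h5).trans (le_of_eq ?_)
    rw [pow_succ]
    field_simp
  have hlim := ((hB.const_mul ε).add (hE.const_mul |E|)).add
    ((tendsto_inv_atTop_nhds_zero_nat (𝕜 := ℝ)).const_mul (M * ((|D| + |χ|) * B)))
  rw [mul_zero, mul_zero, add_zero, add_zero] at hlim
  have hlt : ε * (c / (l + 1)) < η := by
    have h1 : ε * (c / (l + 1) + 1) = η / 2 := div_mul_cancel₀ _ (by positivity)
    nlinarith
  obtain ⟨n₀, hn₀⟩ := eventually_atTop.1 (hlim.eventually_lt_const hlt)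
  refine ⟨max n₀ 0, fun n hn => ?_⟩
  rw [Real.dist_eq, sub_zero]
  exact (hbound n (by omega)).trans_lt (hn₀ n (by omega))

/-! ### Chains of subgroups. -/

/-- The number of chains `⊥ = H_0 < ⋯ < H_l = H` of subgroups. -/
noncomputable def chainCount {G : Type*} [AddCommGroup G] [Fintype G] :
    ℕ → AddSubgroup G → ℕ
  | 0, H => if H = ⊥ then 1 else 0
  | l + 1, H => ∑ H' with H' < H, chainCount l H'

section Chains

variable {G : Type*} [AddCommGroup G] [Fintype G]

lemma ncard_chains_eq_chainCount (l : ℕ) (H : AddSubgroup G) :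
    {c : Fin (l + 1) → AddSubgroup G | c 0 = ⊥ ∧ c (Fin.last l) = H ∧ StrictMono c}.ncard =
      chainCount l H := by
  induction l generalizing H with
  | zero =>
    rw [chainCount]
    split_ifs with h
    · rw [Set.ncard_eq_one]
      refine ⟨fun _ => ⊥, Set.ext fun c => ⟨?_, ?_⟩⟩
      · rintro ⟨h0, -⟩
        ext1 i
        rw [Subsingleton.elim (α := Fin 1) i 0, h0]
      · rintro rfl
        exact ⟨rfl, h.symm, fun i j hij => absurd hij (by simp [Subsingleton.elim (α := Fin 1) i j])⟩
    · refine (Set.ncard_eq_zero (Set.toFinite _)).2 (Set.eq_empty_of_forall_notMem ?_)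
      rintro c ⟨h0, h1, -⟩
      exact h (h1.symm.trans h0)
  | succ l ih =>
    rw [chainCount]
    simp_rw [← ih]
    have himg : {c : Fin (l + 1 + 1) → AddSubgroup G | c 0 = ⊥ ∧ c (Fin.last (l + 1)) = H ∧
        StrictMono c} = (fun c : Fin (l + 1) → AddSubgroup G =>
          (Fin.snoc c H : Fin (l + 1 + 1) → AddSubgroup G)) '' ⋃ H' ∈ Finset.univ.filter (· < H),
        {c : Fin (l + 1) → AddSubgroup G | c 0 = ⊥ ∧ c (Fin.last l) = H' ∧ StrictMono c} := by
      ext c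
      simp only [Set.mem_image, Set.mem_iUnion, Finset.mem_filter, Finset.mem_univ, true_and]
      constructor
      · rintro ⟨h0, hl, hc⟩
        refine ⟨Fin.init c, ⟨c (Fin.last l).castSucc, ?_, ?_, rfl, ?_⟩, ?_⟩
        · rw [← hl]; exact hc (Fin.castSucc_lt_last _)
        · exact h0
        · exact fun i j hij => hc (Fin.castSucc_lt_castSucc_iff.2 hij)
        · rw [← hl]; exact Fin.snoc_init_self c
      · rintro ⟨d, ⟨H', hH', h0, hl, hd⟩, rfl⟩
        refine ⟨?_, by simp, ?_⟩
        · rw [← h0]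
          exact Fin.snoc_castSucc (α := fun _ => AddSubgroup G) H d 0
        · rw [Fin.strictMono_iff_lt_succ]
          intro i
          refine Fin.lastCases ?_ (fun i => ?_) i
          · rw [Fin.succ_last, Fin.snoc_last, Fin.snoc_castSucc, hl]; exact hH'
          · rw [Fin.succ_castSucc, Fin.snoc_castSucc, Fin.snoc_castSucc]
            exact hd (Fin.castSucc_lt_succ)
    have hinj : Function.Injective fun c : Fin (l + 1) → AddSubgroup G =>
        (Fin.snoc c H : Fin (l + 1 + 1) → AddSubgroup G) := fun c d h => (Fin.snoc_inj.1 h).1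
    rw [himg, Set.ncard_image_of_injective _ hinj, Set.ncard_eq_toFinset_card']
    have : (⋃ H' ∈ Finset.univ.filter (· < H),
        {c : Fin (l + 1) → AddSubgroup G | c 0 = ⊥ ∧ c (Fin.last l) = H' ∧ StrictMono c}).toFinset =
        (Finset.univ.filter (· < H)).biUnion fun H' =>
        {c : Fin (l + 1) → AddSubgroup G | c 0 = ⊥ ∧ c (Fin.last l) = H' ∧
          StrictMono c}.toFinset := by
      ext c; simp; tauto
    rw [this, Finset.card_biUnion]
    · simp_rw [Set.ncard_eq_toFinset_card']
    · intro A _ B _ hAB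
      refine Finset.disjoint_left.2 fun c hc hc' => hAB ?_
      simp only [Set.mem_toFinset, Set.mem_ofPred_eq] at hc hc'
      rw [← hc.2.1, hc'.2.1]

variable {p : ℕ} [Fact p.Prime] {L : ℕ}

lemma mul_card_le_of_lt (hG : Nat.card G = p ^ L) {H H' : AddSubgroup G} (h : H' < H) :
    p * Nat.card H' ≤ Nat.card H := by
  have hp : p.Prime := Fact.out
  obtain ⟨i, -, hi⟩ := (Nat.dvd_prime_pow hp).1 (hG ▸ AddSubgroup.card_addSubgroup_dvd_card H)
  obtain ⟨j, -, hj⟩ := (Nat.dvd_prime_pow hp).1 (hG ▸ AddSubgroup.card_addSubgroup_dvd_card H')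
  have hlt : Nat.card H' < Nat.card H := by
    by_contra! hge
    exact h.ne (AddSubgroup.eq_of_le_of_card_ge h.le hge)
  rw [hi, hj] at *
  rw [← pow_succ']
  exact Nat.pow_le_pow_right hp.pos ((Nat.pow_lt_pow_iff_right hp.one_lt).1 hlt)

/-- Each strict inclusion in a `p`-group multiplies the order by at least `p`. -/
lemma chainCount_eq_zero (hG : Nat.card G = p ^ L) (l : ℕ) (H : AddSubgroup G)
    (hH : Nat.card H < p ^ l) : chainCount l H = 0 := by
  induction l generalizing H with
  | zero =>
    simp at hH
  | succ l ih =>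
    rw [chainCount]
    refine Finset.sum_eq_zero fun H' hH' => ih H' ?_
    have := mul_card_le_of_lt hG (H := H) (H' := H') (by simpa using hH')
    rw [pow_succ'] at hH
    exact lt_of_mul_lt_mul_left (this.trans_lt hH) (Nat.zero_le p)

end Chains

/-! ### Asymptotics of the weights. -/

namespace CoeffLaw

variable {ι : Type} [Fintype ι] {μ : CoeffLaw ι}
variable {G : Type*} [AddCommGroup G] [Fintype G] {θ : ℝ}

variable (μ θ) in
/-- The mixing error accumulated by the histories of length `n` generating `H`. -/
noncomputable def genErr (H : AddSubgroup G) (n : ℕ) : ℝ :=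
  (μ.step ⊤ ^ n) (genInd H (mixErr θ H)) []

lemma genErr_nonneg (h0 : 0 < θ) (H : AddSubgroup G) (n : ℕ) : 0 ≤ μ.genErr θ H n :=
  μ.step_pow_nonneg (genInd_nonneg H (mixErr_nonneg h0 H)) n _

lemma genErr_bot (n : ℕ) : μ.genErr θ (⊥ : AddSubgroup G) n = 0 := by
  have : genInd (⊥ : AddSubgroup G) (mixErr θ ⊥) = 0 := by
    ext u; simp [genInd, mixErr_bot]
  rw [genErr, this, map_zero]; rfl

lemma sum_range_pow_sub_le {r : ℝ} (h0 : 0 < r) (h1 : r < 1) (n : ℕ) :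
    ∑ k ∈ Finset.range n, r ^ (n - 1 - k) ≤ (1 - r)⁻¹ := by
  rw [Finset.sum_range_reflect (fun k => r ^ k) n]
  rw [← tsum_geometric_of_lt_one h0.le h1]
  exact (summable_geometric_of_lt_one h0.le h1).sum_le_tsum _ fun k _ => by positivity

/-- In the last-jump decomposition the error has decayed by `r ^ (n - 1 - k)` since a jump at time
`k`. Summing this geometric factor against weights `O(k ^ l)` gives only `O(n ^ l)`. -/
lemma Contracts.tendsto_genErr (hθ : μ.Contracts G θ) (hT : μ.TranslateBound G) {l : ℕ}
    {H : AddSubgroup G} (hH : ∀ H' < H, ∃ c, Tendsto (fun n => μ.genWeight H' n / (n : ℝ) ^ l)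
      atTop (𝓝 c)) :
    Tendsto (fun n => μ.genErr θ H n / (n : ℝ) ^ (l + 1)) atTop (𝓝 0) := by
  by_cases hbot : H = ⊥
  · subst hbot; simp [genErr_bot]
  obtain ⟨C, r, hC, hr0, hr1, hdec, -, -⟩ := hθ.mixes hT H
  have hr : 0 < 1 - r := by linarith
  have hB : ∀ H' : AddSubgroup G, ∃ B : ℝ, 0 ≤ B ∧ (H' < H → ∀ k : ℕ,
      μ.genWeight H' k ≤ B * ((k : ℝ) + 1) ^ l) := by
    intro H'
    by_cases h : H' < H
    · obtain ⟨c, hc⟩ := hH H' h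
      obtain ⟨B, hB, hB'⟩ := exists_le_mul_add_one_pow hc
      exact ⟨B, hB, fun _ => hB'⟩
    · exact ⟨0, le_rfl, fun h' => absurd h' h⟩
  choose B hB0 hB using hB
  set K := (Fintype.card G * C) * ∑ H' with H' < H, B H' with hK
  have hK0 : 0 ≤ K := mul_nonneg (by positivity) (Finset.sum_nonneg fun _ _ => hB0 _)
  have hle : ∀ n, 0 < n → μ.genErr θ H n / (n : ℝ) ^ (l + 1) ≤
      (K * (1 - r)⁻¹) * (n : ℝ)⁻¹ := by
    intro n hn
    have hn' : (0 : ℝ) < n := by exact_mod_cast hn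
    rw [div_le_iff₀ (by positivity), genErr, step_top_pow_genInd_eq, genInd_nil_of_ne_bot hbot,
      zero_add]
    calc _ ≤ ∑ k ∈ Finset.range n, K * (n : ℝ) ^ l * r ^ (n - 1 - k) := by
          refine Finset.sum_le_sum fun k hk => ?_
          have hk' : ((k : ℝ) + 1) ≤ n := by
            exact_mod_cast Nat.succ_le_of_lt (Finset.mem_range.1 hk)
          rw [hK, Finset.mul_sum, Finset.sum_mul, Finset.sum_mul]
          refine Finset.sum_le_sum fun H' hH' => ?_
          have hlt : H' < H := by simpa using hH'
          refine (step_pow_genInd_le (D := Fintype.card G * (C * r ^ (n - 1 - k)))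
            (fun u _ => step_top_genInd_le (by positivity) (fun v hv => hdec v hv _) u) k).trans ?_
          have h1 : μ.genWeight H' k ≤ B H' * (n : ℝ) ^ l := (hB H' hlt k).trans
            (mul_le_mul_of_nonneg_left (pow_le_pow_left₀ (by positivity) hk' l) (hB0 H'))
          refine (mul_le_mul_of_nonneg_left h1 (by positivity)).trans (le_of_eq (by ring))
      _ = K * (n : ℝ) ^ l * ∑ k ∈ Finset.range n, r ^ (n - 1 - k) := by rw [Finset.mul_sum]
      _ ≤ K * (n : ℝ) ^ l * (1 - r)⁻¹ :=
          mul_le_mul_of_nonneg_left (sum_range_pow_sub_le hr0 hr1 n) (by positivity)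
      _ = _ := by rw [pow_succ]; field_simp
  have hlim := (tendsto_inv_atTop_nhds_zero_nat (𝕜 := ℝ)).const_mul (K * (1 - r)⁻¹)
  rw [mul_zero] at hlim
  refine tendsto_of_tendsto_of_tendsto_of_le_of_le' tendsto_const_nhds hlim
    (Eventually.of_forall fun n => div_nonneg (genErr_nonneg hθ.pos H n) (by positivity)) ?_
  filter_upwards [eventually_gt_atTop 0] with n hn using hle n hn

variable {p : ℕ} [Fact p.Prime] {L : ℕ} {χ : ℝ}

lemma Contracts.abs_step_pow_genInd_sub_le {H' : AddSubgroup G} {g : List G → ℝ} {ε E : ℝ}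
    (hg : ∀ u, gen u = H' → |g u - χ| ≤ ε + E * mixErr θ H' u) (k : ℕ) :
    |(μ.step ⊤ ^ k) (genInd H' g) [] - χ * μ.genWeight H' k| ≤
      ε * μ.genWeight H' k + E * μ.genErr θ H' k := by
  have h1 : ∀ a b : ℝ, (μ.step ⊤ ^ k) (a • genInd H' 1 + b • genInd H' (mixErr θ H')) [] =
      a * μ.genWeight H' k + b * μ.genErr θ H' k := by
    intro a b
    rw [map_add, map_smul, map_smul]; rfl
  rw [abs_le]
  constructor
  · have h2 : (μ.step ⊤ ^ k) ((χ - ε) • genInd H' 1 + (-E) • genInd H' (mixErr θ H')) [] ≤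
        (μ.step ⊤ ^ k) (genInd H' g) [] := by
      refine μ.step_pow_mono_of_le (fun u => ?_) k []
      by_cases h : gen u = H'
      · simp only [Pi.add_apply, Pi.smul_apply, smul_eq_mul, genInd_of_eq h, Pi.one_apply]
        linarith [(abs_le.1 (hg u h)).1]
      · simp [genInd_of_ne h]
    rw [h1] at h2
    linarith
  · have h2 : (μ.step ⊤ ^ k) (genInd H' g) [] ≤
        (μ.step ⊤ ^ k) ((χ + ε) • genInd H' 1 + E • genInd H' (mixErr θ H')) [] := by
      refine μ.step_pow_mono_of_le (fun u => ?_) k []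
      by_cases h : gen u = H'
      · simp only [Pi.add_apply, Pi.smul_apply, smul_eq_mul, genInd_of_eq h, Pi.one_apply]
        linarith [(abs_le.1 (hg u h)).2]
      · simp [genInd_of_ne h]
    rw [h1] at h2
    linarith

/-- Growth of the weight of the histories generating `H`. -/
theorem Contracts.tendsto_genWeight (hθ : μ.Contracts G θ) (hT : μ.TranslateBound G)
    (hG : Nat.card G = p ^ L) (hχ : Tendsto (μ.firstNeZeroWeight p) atTop (𝓝 χ)) (l : ℕ)
    (H : AddSubgroup G) (hH : Nat.card H ≤ p ^ l) :
    Tendsto (fun n => μ.genWeight H n / (n : ℝ) ^ l) atTop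
      (𝓝 (χ ^ l * chainCount l H / l.factorial)) ∧
    Tendsto (fun n => μ.genErr θ H n / (n : ℝ) ^ l) atTop (𝓝 0) := by
  induction l generalizing H with
  | zero =>
    have hbot : H = ⊥ := by
      rw [pow_zero] at hH
      exact AddSubgroup.eq_bot_of_card_le H hH
    subst hbot
    simp [genWeight_bot, genErr_bot, chainCount]
  | succ l ih =>
    have hlt : ∀ H' < H, Nat.card H' ≤ p ^ l := fun H' h => by
      have := (mul_card_le_of_lt hG h).trans hH
      rw [pow_succ'] at this
      exact le_of_mul_le_mul_left this (Fact.out : p.Prime).pos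
    refine ⟨?_, hθ.tendsto_genErr hT fun H' h => ⟨_, (ih H' (hlt H' h)).1⟩⟩
    -- The trivial subgroup has constant weight `1`, hence limit `0` after division by `n ^ (l +
    -- 1)`; it has no chain of positive length either.
    by_cases hbot : H = ⊥
    · subst hbot
      have : (Finset.univ.filter (· < (⊥ : AddSubgroup G))) = ∅ := by simp
      simp only [genWeight_bot, chainCount, this, Finset.sum_empty, Nat.cast_zero, mul_zero,
        zero_div, one_div]
      exact (tendsto_pow_atTop (by omega)).comp tendsto_natCast_atTop_atTop |>.inv_tendsto_atTop
    obtain ⟨C, r, hC, hr0, hr1, -, -, hbd⟩ := hθ.mixes hT H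
    have hone : ∀ H' ∈ Finset.univ.filter (· < H), Tendsto (fun n : ℕ =>
        (∑ k ∈ Finset.range n, (μ.step ⊤ ^ k)
          (genInd H' (μ.step ⊤ (genInd H ((μ.step H ^ (n - 1 - k)) 1)))) []) / (n : ℝ) ^ (l + 1))
        atTop (𝓝 (χ * ((χ ^ l * chainCount l H' / l.factorial) / (l + 1)))) := by
      intro H' hH'
      have hH'lt : H' < H := by simpa using hH'
      obtain ⟨hw, he⟩ := ih H' (hlt H' hH'lt)
      have hJ0 : ∀ m k, 0 ≤ (μ.step ⊤ ^ k)
          (genInd H' (μ.step ⊤ (genInd H ((μ.step H ^ m) 1)))) ([] : List G) := fun m k =>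
        μ.step_pow_nonneg (genInd_nonneg H' fun u => by
          simpa using μ.step_pow_nonneg (H := ⊤) (genInd_nonneg H
            (μ.step_pow_nonneg (f := 1) (fun _ => zero_le_one) m)) 1 u) k []
      have hJ1 : ∀ m k, (μ.step ⊤ ^ k)
          (genInd H' (μ.step ⊤ (genInd H ((μ.step H ^ m) 1)))) ([] : List G) ≤
          Fintype.card G * C * μ.genWeight H' k := fun m k =>
        step_pow_genInd_le (fun u _ => step_top_genInd_le hC (fun v hv => hbd v hv m) u) k
      -- If `|H'| < p ^ l`, the weight of `H'` is `o(n ^ l)` and its jumps are negligible. Otherwise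
      -- the bounds on orders force index exactly `p`, and each jump contributes `χ`.
      rcases (hlt H' hH'lt).lt_or_eq with hc | hc
      · have hz := chainCount_eq_zero hG l H' hc
        rw [hz] at hw ⊢
        simp only [Nat.cast_zero, mul_zero, zero_div] at hw ⊢
        have hlim := (tendsto_sum_div_pow_of_zero hw).const_mul (Fintype.card G * C)
        rw [mul_zero] at hlim
        refine squeeze_zero (fun n => div_nonneg (Finset.sum_nonneg fun k _ => hJ0 _ k)
          (by positivity)) (fun n => ?_) hlim
        rw [← mul_div_assoc, Finset.mul_sum]
        exact div_le_div_of_nonneg_right (Finset.sum_le_sum fun k _ => hJ1 _ k) (by positivity)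
      · have hcard : Nat.card H = p * Nat.card H' := by
          refine le_antisymm ?_ (mul_card_le_of_lt hG hH'lt)
          rw [hc, ← pow_succ']; exact hH
        refine tendsto_sum_conv (t := fun k m => (μ.step ⊤ ^ k)
          (genInd H' (μ.step ⊤ (genInd H ((μ.step H ^ m) 1)))) [])
          (genWeight_nonneg H') (genErr_nonneg hθ.pos H') hw he
          (D := Fintype.card G * C) (fun k m => ?_) fun ε hε => ?_
        · rw [abs_of_nonneg (hJ0 m k)]; exact hJ1 m k
        · obtain ⟨M, E, hME⟩ :=
            hθ.exists_abs_jump_sub_lim_le (hθ.mixes hT H) hH'lt.le hcard hχ hε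
          exact ⟨M, E, fun m hm k => abs_step_pow_genInd_sub_le (hME m hm) k⟩
    have hsum := tendsto_finsetSum _ hone
    have hval : ∑ H' with H' < H, χ * ((χ ^ l * (chainCount l H' : ℝ) / l.factorial) / (l + 1)) =
        χ ^ (l + 1) * chainCount (l + 1) H / (l + 1).factorial := by
      rw [chainCount, Nat.factorial_succ]
      push_cast
      rw [Finset.mul_sum, Finset.sum_div]
      refine Finset.sum_congr rfl fun H' _ => ?_
      rw [pow_succ]
      field_simp
    rw [hval] at hsum
    refine hsum.congr fun n => ?_
    rw [genWeight, step_top_pow_genInd_eq, genInd_nil_of_ne_bot hbot, zero_add,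
      Finset.sum_comm (s := Finset.range n), Finset.sum_div]

theorem Contracts.tendsto_step_top_pow (hθ : μ.Contracts G θ) (hT : μ.TranslateBound G)
    (hG : Nat.card G = p ^ L) (hχ : Tendsto (μ.firstNeZeroWeight p) atTop (𝓝 χ)) :
    Tendsto (fun n : ℕ => (μ.step ⊤ ^ n) 1 ([] : List G) / (n : ℝ) ^ L) atTop
      (𝓝 (χ ^ L * maximalChainCount G L / L.factorial)) := by
  have hle : ∀ K : AddSubgroup G, Nat.card K ≤ p ^ L := fun K =>
    hG ▸ Nat.card_le_card_of_injective _ K.subtype_injective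
  have h := tendsto_finsetSum Finset.univ fun K (_ : K ∈ Finset.univ) =>
    (hθ.tendsto_genWeight hT hG hχ L K (hle K)).1
  have hval : ∑ K : AddSubgroup G, χ ^ L * (chainCount L K : ℝ) / L.factorial =
      χ ^ L * maximalChainCount G L / L.factorial := by
    rw [Finset.sum_eq_single ⊤ _ (by simp), ← ncard_chains_eq_chainCount]
    · rfl
    · intro K _ hK
      rw [chainCount_eq_zero hG L K, Nat.cast_zero, mul_zero, zero_div]
      refine lt_of_le_of_ne (hle K) fun h => hK ?_
      exact AddSubgroup.eq_top_of_card_eq K (h.trans hG.symm)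
  rw [hval] at h
  refine h.congr fun n => ?_
  rw [step_pow_nil_eq_sum_genWeight, Finset.sum_div]
  simp

end CoeffLaw

/-! ### From random matrices to the transfer operator. -/

lemma val_intCast_zsmul {G : Type*} [AddCommGroup G] {N : ℕ} [NeZero N]
    (hN : ∀ x : G, N • x = 0) (z : ℤ) (x : G) : (((z : ZMod N).val : ℤ)) • x = z • x := by
  rw [ZMod.val_intCast]
  conv_rhs => rw [← Int.emod_add_mul_ediv z N]
  rw [add_zsmul, mul_comm, mul_zsmul, natCast_zsmul, hN, smul_zero, add_zero]

section Law

variable {Ω₀ : Type*} [MeasurableSpace Ω₀] (P₀ : Measure Ω₀) [IsProbabilityMeasure P₀]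
  {ξ : Ω₀ → ℤ} (hξ : Measurable ξ)

/-- The law of `ξ` modulo `N`. -/
noncomputable def modLaw (N : ℕ) [NeZero N] : CoeffLaw (ZMod N) where
  weight a := P₀.real ((fun ω => (ξ ω : ZMod N)) ⁻¹' {a})
  coeff a := (a.val : ℤ)
  weight_nonneg _ := measureReal_nonneg
  sum_weight := by
    have hm : Measurable fun ω => ξ ω := hξ
    rw [sum_measureReal_preimage_singleton]
    · simp
    · intro y _
      exact hm (MeasurableSet.of_discrete (s := {z : ℤ | (z : ZMod N) = y}))

lemma indepFun_measureReal {Ω A B : Type*} [MeasurableSpace Ω] {P : Measure Ω} [MeasurableSpace A]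
    [MeasurableSpace B] [DiscreteMeasurableSpace A] [DiscreteMeasurableSpace B] {f : Ω → A}
    {g : Ω → B} (h : IndepFun f g P) (S : Set A) (T : Set B) :
    P.real {ω | f ω ∈ S ∧ g ω ∈ T} = P.real {ω | f ω ∈ S} * P.real {ω | g ω ∈ T} := by
  have := h.measure_inter_preimage_eq_mul S T .of_discrete .of_discrete
  simp only [measureReal_def, ← ENNReal.toReal_mul]
  exact congrArg ENNReal.toReal this

variable {Ω : Type*} [MeasurableSpace Ω] {P : Measure Ω} [IsProbabilityMeasure P]

/-- Condition on the last coefficient modulo `N`, which multiplies the head of the history; only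
residues matter because `N` kills `G`. -/
lemma measureReal_sum_zsmul_eq {N : ℕ} [NeZero N] {G : Type*} [AddCommGroup G]
    (hN : ∀ x : G, N • x = 0) {k : ℕ} (X : Fin k → Ω → ℤ) (hX : ∀ j, Measurable (X j))
    (hind : iIndepFun X P) (hid : ∀ j, IdentDistrib (X j) ξ P P₀) (v : Fin k → G) (s : G) :
    P.real {ω | ∑ j, X j ω • v j = s} = (modLaw P₀ hξ N).sumLaw (pre v k) s := by
  induction k generalizing s with
  | zero =>
    simp only [Finset.univ_eq_empty, Finset.sum_empty]
    rw [show pre v 0 = [] by simp [pre], CoeffLaw.sumLaw_nil]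
    by_cases h : s = 0
    · simp [h]
    · simp [h, Ne.symm h]
  | succ k ih =>
    have hv : v = Fin.snoc (Fin.init v) (v (Fin.last k)) := (Fin.snoc_init_self v).symm
    have ih' := ih (fun j => X j.castSucc) (fun j => hX _)
      (hind.precomp (Fin.castSucc_injective k)) (fun j => hid _) (Fin.init v)
    set x := v (Fin.last k) with hx
    have hpre : pre v (k + 1) = x :: pre (Fin.init v) k := by
      rw [hv, pre_snoc_self, Fin.snoc_init_self]
    rw [hpre, CoeffLaw.sumLaw_cons]
    have hset : {ω | ∑ j, X j ω • v j = s} = ⋃ a ∈ (Finset.univ : Finset (ZMod N)),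
        {ω | ∑ j : Fin k, X j.castSucc ω • Fin.init v j = s - (a.val : ℤ) • x ∧
          (X (Fin.last k) ω : ZMod N) = a} := by
      ext ω
      simp only [Finset.mem_univ, Set.iUnion_true, Set.mem_iUnion, Set.mem_ofPred_eq,
        Fin.sum_univ_castSucc, Fin.init]
      rw [exists_eq_right', val_intCast_zsmul hN, eq_sub_iff_add_eq]
    have hind2 : ∀ a : ZMod N,
        P.real {ω | ∑ j : Fin k, X j.castSucc ω • Fin.init v j = s - (a.val : ℤ) • x ∧
          (X (Fin.last k) ω : ZMod N) = a} =
        P.real {ω | ∑ j : Fin k, X j.castSucc ω • Fin.init v j = s - (a.val : ℤ) • x} *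
        P.real {ω | (X (Fin.last k) ω : ZMod N) = a} := by
      intro a
      have hd : Disjoint (Finset.univ.image (Fin.castSucc (n := k))) {Fin.last k} := by
        simp
      have h := hind.indepFun_finset _ _ hd hX
      exact indepFun_measureReal h
        {y | ∑ j : Fin k, y ⟨j.castSucc, by simp⟩ • Fin.init v j = s - (a.val : ℤ) • x}
        {y | ((y ⟨Fin.last k, by simp⟩ : ℤ) : ZMod N) = a}
    have hmeas : ∀ j (T : Set ℤ), MeasurableSet {ω | X j ω ∈ T} := fun j T => hX j .of_discrete
    rw [hset, measureReal_biUnion_finset]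
    · refine Finset.sum_congr rfl fun a _ => ?_
      rw [hind2, ih', mul_comm]
      congr 1
      have := (hid (Fin.last k)).measure_mem_eq (s := {z : ℤ | (z : ZMod N) = a}) .of_discrete
      exact congrArg ENNReal.toReal this
    · intro a _ b _ hab
      refine Set.disjoint_left.2 fun ω ha hb => hab ?_
      exact ha.2.symm.trans hb.2
    · intro a _
      have hm : Measurable fun ω => fun j => X j ω := measurable_pi_iff.2 hX
      exact hm (MeasurableSet.of_discrete (s := {y : Fin (k + 1) → ℤ |
        ∑ j : Fin k, y j.castSucc • Fin.init v j = s - (a.val : ℤ) • x ∧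
          (y (Fin.last k) : ZMod N) = a}))

end Law

section Matrix

variable {Ω₀ : Type*} [MeasurableSpace Ω₀] {P₀ : Measure Ω₀} [IsProbabilityMeasure P₀]
  {ξ : Ω₀ → ℤ} (hξ : Measurable ξ) {Ω : Type*} [MeasurableSpace Ω] {P : Measure Ω}
  [IsProbabilityMeasure P] {n : ℕ} {L : Ω → Matrix (Fin n) (Fin n) ℤ}
  (hL : IsIIDLowerTriangular P₀ ξ P L) {G : Type*} [AddCommGroup G]

include hL

omit [IsProbabilityMeasure P₀] [IsProbabilityMeasure P] in
lemma measurableSet_matrix (T : Set (Matrix (Fin n) (Fin n) ℤ)) :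
    MeasurableSet {ω | L ω ∈ T} := by
  have hm : Measurable fun ω => (fun e : Fin n × Fin n => L ω e.1 e.2) :=
    measurable_pi_iff.2 fun e => hL.measurable_entry e.1 e.2
  exact hm (MeasurableSet.of_discrete (s := {y : Fin n × Fin n → ℤ | (fun i j => y (i, j)) ∈ T}))

include hξ in
lemma measureReal_row_eq {N : ℕ} [NeZero N] (hN : ∀ x : G, N • x = 0) (v : Fin n → G) (i : Fin n)
    (s : G) : P.real {ω | ∑ j, L ω i j • v j = s} =
      (modLaw P₀ hξ N).sumLaw (pre v (i + 1)) s := by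
  have hle : (i : ℕ) + 1 ≤ n := i.2
  have hji : ∀ j : Fin (i + 1), Fin.castLE hle j ≤ i := fun j => by
    rw [Fin.le_def]; exact Nat.lt_succ_iff.1 j.2
  have h := measureReal_sum_zsmul_eq P₀ hξ hN
    (fun (j : Fin (i + 1)) ω => L ω i (Fin.castLE hle j)) (fun j => hL.measurable_entry _ _)
    (hL.iIndepFun_entry.precomp
      (g := fun j : Fin (i + 1) => ⟨(i, Fin.castLE hle j), hji j⟩) (fun j j' hjj => by
        simpa using congrArg (fun e => e.1.2) hjj))
    (fun j => hL.identDistrib _ _ (hji j)) (fun j => v (Fin.castLE hle j)) s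
  have hpre : pre (fun j : Fin (i + 1) => v (Fin.castLE hle j)) (i + 1) = pre v (i + 1) := by
    rw [pre, pre]
    congr 1
    apply List.ext_getElem
    · simp [hle]
    · intro j h1 h2
      rw [List.getElem_take, List.getElem_take, List.getElem_ofFn, List.getElem_ofFn]
      rfl
  rw [← hpre, ← h]
  congr 1
  ext ω
  simp only [Set.mem_ofPred_eq]
  rw [← Finset.sum_image (s := Finset.univ) (g := Fin.castLE hle) (f := fun j => L ω i j • v j)
    (fun a _ b _ hab => Fin.castLE_injective hle hab)]
  rw [← Finset.sum_subset (Finset.subset_univ (Finset.univ.image (Fin.castLE hle)))]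
  intro j _ hj
  rw [hL.eq_zero_of_lt ω i j, zero_smul]
  by_contra hlt
  refine hj (Finset.mem_image.2 ⟨⟨j, Nat.lt_succ_iff.2 (Fin.le_def.1 (not_lt.1 hlt))⟩, by simp, ?_⟩)
  ext; simp

-- Different rows use disjoint sets of independent entries, so they can be split off one at a time.
omit [IsProbabilityMeasure P₀] in
lemma measureReal_forall_lt_row_eq (v : Fin n → G) (s : Fin n → G) (k : ℕ) (hk : k ≤ n) :
    P.real {ω | ∀ i : Fin n, (i : ℕ) < k → ∑ j, L ω i j • v j = s i} =
      ∏ i : Fin k, P.real {ω | ∑ j, L ω (Fin.castLE hk i) j • v j = s (Fin.castLE hk i)} := by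
  induction k with
  | zero => simp
  | succ k ih =>
    rw [Fin.prod_univ_castSucc]
    have hk' : k ≤ n := by omega
    rw [show (∏ i : Fin k, P.real {ω | ∑ j, L ω (Fin.castLE hk i.castSucc) j • v j =
      s (Fin.castLE hk i.castSucc)}) = P.real {ω | ∀ i : Fin n, (i : ℕ) < k →
        ∑ j, L ω i j • v j = s i} from (ih hk').symm]
    set r : Fin n := Fin.castLE hk (Fin.last k) with hr
    have hrk : (r : ℕ) = k := by simp [hr]
    let S : Finset {e : Fin n × Fin n // e.2 ≤ e.1} := Finset.univ.filter fun e => (e.1.1 : ℕ) < k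
    let T : Finset {e : Fin n × Fin n // e.2 ≤ e.1} := Finset.univ.filter fun e => e.1.1 = r
    have hd : Disjoint S T := Finset.disjoint_filter.2 fun e _ h1 h2 => by
      rw [h2, hrk] at h1; exact lt_irrefl _ h1
    have h := hL.iIndepFun_entry.indepFun_finset S T hd fun e => hL.measurable_entry _ _
    -- Filling in zeros outside `U` writes the row events as functions of the entries indexed by `U`
    -- alone, as independence of the two blocks requires.
    let ext : ∀ U : Finset {e : Fin n × Fin n // e.2 ≤ e.1}, (U → ℤ) → Matrix (Fin n) (Fin n) ℤ :=
      fun U y i j => if h : j ≤ i then if h' : (⟨(i, j), h⟩ : {e : Fin n × Fin n // e.2 ≤ e.1}) ∈ U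
        then y ⟨_, h'⟩ else 0 else 0
    have hext : ∀ (U : Finset {e : Fin n × Fin n // e.2 ≤ e.1}) ω i,
        (∀ j (h : j ≤ i), (⟨(i, j), h⟩ : {e : Fin n × Fin n // e.2 ≤ e.1}) ∈ U) →
        ∀ j, ext U (fun e => L ω e.1.1.1 e.1.1.2) i j = L ω i j := by
      intro U ω i hi j
      by_cases hj : j ≤ i
      · simp only [ext]; rw [dif_pos hj, dif_pos (hi j hj)]
      · simp only [ext]; rw [dif_neg hj, hL.eq_zero_of_lt ω i j (not_le.1 hj)]
    have h2 := indepFun_measureReal h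
      {y | ∀ i : Fin n, (i : ℕ) < k → ∑ j, ext S y i j • v j = s i}
      {y | ∑ j, ext T y r j • v j = s r}
    have hS : ∀ ω (i : Fin n), (i : ℕ) < k →
        ∑ j, ext S (fun e => L ω e.1.1.1 e.1.1.2) i j • v j = ∑ j, L ω i j • v j := by
      intro ω i hi
      exact Finset.sum_congr rfl fun j _ => by rw [hext S ω i fun j hj => by simpa [S] using hi]
    have hT : ∀ ω, ∑ j, ext T (fun e => L ω e.1.1.1 e.1.1.2) r j • v j = ∑ j, L ω r j • v j := by
      intro ω
      exact Finset.sum_congr rfl fun j _ => by rw [hext T ω r fun j hj => by simp [T]]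
    simp only [Set.mem_ofPred_eq, hT] at h2
    have hS2 : ∀ ω, (∀ i : Fin n, (i : ℕ) < k →
        ∑ j, ext S (fun e => L ω e.1.1.1 e.1.1.2) i j • v j = s i) ↔
        ∀ i : Fin n, (i : ℕ) < k → ∑ j, L ω i j • v j = s i := fun ω =>
      forall_congr' fun i => imp_congr_right fun hi => by rw [hS ω i hi]
    simp only [hS2] at h2
    rw [← h2]
    congr 1
    ext ω
    simp only [Set.mem_ofPred_eq]
    constructor
    · exact fun h => ⟨fun i hi => h i (by omega), h r (by omega)⟩
    · rintro ⟨h1, h3⟩ i hi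
      rcases Nat.lt_succ_iff_lt_or_eq.1 hi with h4 | h4
      · exact h1 i h4
      · rw [show i = r from Fin.ext (h4.trans hrk.symm)]; exact h3

include hξ in
lemma measureReal_matrix_eq {N : ℕ} [NeZero N] (hN : ∀ x : G, N • x = 0) (v : Fin n → G)
    (s : Fin n → G) : P.real {ω | ∀ i, ∑ j, L ω i j • v j = s i} =
      ∏ i : Fin n, (modLaw P₀ hξ N).sumLaw (pre v (i + 1)) (s i) := by
  have h := measureReal_forall_lt_row_eq hL v s n le_rfl
  simp only [Fin.is_lt, forall_true_left, Fin.castLE_refl] at h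
  rw [h]
  exact Finset.prod_congr rfl fun i _ => measureReal_row_eq hξ hL hN v i (s i)

end Matrix

lemma ncard_eq_sum_indicator {Ω α : Type*} [Fintype α] (E : α → Set Ω) (ω : Ω) :
    (({a | ω ∈ E a}.ncard : ℕ) : ℝ) = ∑ a, (E a).indicator 1 ω := by
  rw [Set.ncard_eq_toFinset_card']
  simp [Set.indicator_apply]

lemma integral_ncard_eq {Ω α : Type*} [MeasurableSpace Ω] {P : Measure Ω} [IsFiniteMeasure P]
    [Fintype α] {E : α → Set Ω} (hE : ∀ a, MeasurableSet (E a)) :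
    ∫ ω, (({a | ω ∈ E a}.ncard : ℕ) : ℝ) ∂P = ∑ a, P.real (E a) := by
  simp_rw [ncard_eq_sum_indicator]
  rw [integral_finsetSum]
  · exact Finset.sum_congr rfl fun a _ => integral_indicator_one (hE a)
  · exact fun a _ => (integrable_const (1 : ℝ)).indicator (hE a)

lemma integrable_ncard {Ω α : Type*} [MeasurableSpace Ω] {P : Measure Ω} [IsFiniteMeasure P]
    [Fintype α] {E : α → Set Ω} (hE : ∀ a, MeasurableSet (E a)) :
    Integrable (fun ω => (({a | ω ∈ E a}.ncard : ℕ) : ℝ)) P := by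
  simp_rw [ncard_eq_sum_indicator]
  exact integrable_finsetSum _ fun a _ => (integrable_const (1 : ℝ)).indicator (hE a)

/-- Subtracting one fixed solution injects the inhomogeneous solutions into the homogeneous ones. -/
lemma ncard_solutions_le {G : Type*} [AddCommGroup G] [Finite G] {n : ℕ} (K : AddSubgroup G)
    (A : Matrix (Fin n) (Fin n) ℤ) (s : Fin n → G) :
    {v : Fin n → K | ∀ i, ∑ j, A i j • (v j : G) = s i}.ncard ≤
      {v : Fin n → K | ∀ i, ∑ j, A i j • (v j : G) = 0}.ncard := by
  rcases Set.eq_empty_or_nonempty {v : Fin n → K | ∀ i, ∑ j, A i j • (v j : G) = s i} with h | h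
  · rw [h, Set.ncard_empty]; exact Nat.zero_le _
  · obtain ⟨w, hw⟩ := h
    refine Set.ncard_le_ncard_of_injOn (fun v => v - w) (fun v hv i => ?_)
      (fun a _ b _ hab => sub_left_injective hab) (Set.toFinite _)
    simp only [Pi.sub_apply, AddSubgroup.coe_sub, smul_sub, Finset.sum_sub_distrib]
    rw [hv i, hw i, sub_self]

section Expectation

variable {Ω₀ : Type*} [MeasurableSpace Ω₀] {P₀ : Measure Ω₀} [IsProbabilityMeasure P₀]
  {ξ : Ω₀ → ℤ} (hξ : Measurable ξ) {N : ℕ} [NeZero N]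

lemma translateBound_modLaw {Ω : ℕ → Type*} [∀ n, MeasurableSpace (Ω n)] {P : ∀ n, Measure (Ω n)}
    [∀ n, IsProbabilityMeasure (P n)] {L : ∀ n, Ω n → Matrix (Fin n) (Fin n) ℤ}
    (hL : ∀ n, IsIIDLowerTriangular P₀ ξ (P n) (L n)) {G : Type*} [AddCommGroup G] [Fintype G]
    (hN : ∀ x : G, N • x = 0) : (modLaw P₀ hξ N).TranslateBound G := by
  intro K n s
  have hm : ∀ (s : Fin n → G) (v : Fin n → K),
      MeasurableSet {ω | ∀ i, ∑ j, L n ω i j • (v j : G) = s i} := fun s v =>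
    measurableSet_matrix (hL n) {A | ∀ i, ∑ j, A i j • (v j : G) = s i}
  have h : ∀ s : Fin n → G, ∑ v : Fin n → K,
      ∏ i : Fin n, (modLaw P₀ hξ N).sumLaw (pre (fun j => (v j : G)) (i + 1)) (s i) =
      ∫ ω, (({v : Fin n → K | ω ∈ {ω | ∀ i, ∑ j, L n ω i j • (v j : G) = s i}}.ncard : ℕ) : ℝ)
        ∂(P n) := by
    intro s
    rw [integral_ncard_eq (hm s)]
    exact Finset.sum_congr rfl fun v _ => (measureReal_matrix_eq hξ (hL n) hN _ s).symm
  rw [h s, h fun _ => 0]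
  refine integral_mono (integrable_ncard (hm s)) (integrable_ncard (hm fun _ => 0)) fun ω => ?_
  exact Nat.cast_le.2 (ncard_solutions_le K (L n ω) s)

lemma step_top_pow_nil_eq_sum {ι : Type} [Fintype ι] (μ : CoeffLaw ι) {G : Type*} [AddCommGroup G]
    [Fintype G] (n : ℕ) (u : List G) : (μ.step ⊤ ^ n) 1 u =
      ∑ v : Fin n → G, ∏ i : Fin n, μ.sumLaw (pre v (i + 1) ++ u) 0 := by
  rw [CoeffLaw.step_pow_eq_sum]
  simp only [Pi.one_apply, mul_one]
  exact Equiv.sum_comp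
    (Equiv.piCongrRight fun _ : Fin n => (AddSubgroup.topEquiv (G := G)).toEquiv)
    (fun v : Fin n → G => ∏ i : Fin n, μ.sumLaw (pre v (i + 1) ++ u) 0)

variable {Ω : Type*} [MeasurableSpace Ω] {P : Measure Ω} [IsProbabilityMeasure P]

lemma expectedKernelCard_eq {n : ℕ} {L : Ω → Matrix (Fin n) (Fin n) ℤ}
    (hL : IsIIDLowerTriangular P₀ ξ P L) {G : Type*} [AddCommGroup G] [Fintype G]
    (hN : ∀ x : G, N • x = 0) :
    expectedKernelCard P L G = ((modLaw P₀ hξ N).step ⊤ ^ n) 1 ([] : List G) := by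
  rw [step_top_pow_nil_eq_sum]
  simp only [List.append_nil]
  have hm : ∀ v : Fin n → G, MeasurableSet {ω | ∀ i, ∑ j, L ω i j • v j = 0} := fun v =>
    measurableSet_matrix hL {A | ∀ i, ∑ j, A i j • v j = 0}
  refine (integral_ncard_eq hm).trans ?_
  exact Finset.sum_congr rfl fun v _ => measureReal_matrix_eq hξ hL hN v fun _ => 0

/-- The first coordinate sits at the end of every history, so conditioning on it means starting from
the history `[y]`. -/
lemma pre_cons {G : Type*} {n : ℕ} (y : G) (v : Fin n → G) (k : ℕ) :
    pre (Fin.cons y v : Fin (n + 1) → G) (k + 1) = pre v k ++ [y] := by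
  simp [pre, List.ofFn_succ]

lemma expectedKernelCardFirstNeZero_eq {p : ℕ} [Fact p.Prime] {m : ℕ}
    {L : Ω → Matrix (Fin (m + 1)) (Fin (m + 1)) ℤ} (hL : IsIIDLowerTriangular P₀ ξ P L)
    (hN : ∀ x : ZMod p, N • x = 0) :
    expectedKernelCardFirstNeZero p P L = (modLaw P₀ hξ N).firstNeZeroWeight p m := by
  set E : (Fin (m + 1) → ZMod p) → Set Ω := fun v =>
    if v 0 ≠ 0 then {ω | ∀ i, ∑ j, L ω i j • v j = 0} else ∅ with hE
  have hm : ∀ v, MeasurableSet (E v) := by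
    intro v
    by_cases h : v 0 ≠ 0
    · simp only [hE, if_pos h]
      exact measurableSet_matrix hL {A | ∀ i, ∑ j, A i j • v j = 0}
    · simp only [hE, if_neg h]; exact MeasurableSet.empty
  have hset : ∀ ω, {v : Fin (m + 1) → ZMod p | (∃ h : 0 < m + 1, v ⟨0, h⟩ ≠ 0) ∧
      v ∈ kernelVectors (L ω) (ZMod p)} = {v | ω ∈ E v} := by
    intro ω
    ext v
    by_cases h : v 0 = 0
    · simp [hE, h]
    · simp [hE, h, kernelVectors]
  rw [expectedKernelCardFirstNeZero]
  simp_rw [hset]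
  rw [integral_ncard_eq hm, ← (Fin.consEquiv (fun _ : Fin (m + 1) => ZMod p)).sum_comp,
    Fintype.sum_prod_type, CoeffLaw.firstNeZeroWeight, Finset.sum_filter]
  refine Finset.sum_congr rfl fun y _ => ?_
  split_ifs with hy
  · rw [step_top_pow_nil_eq_sum, Finset.mul_sum]
    refine Finset.sum_congr rfl fun v _ => ?_
    change P.real (E (Fin.cons y v : Fin (m + 1) → ZMod p)) = _
    simp only [hE, Fin.cons_zero, if_pos hy]
    rw [measureReal_matrix_eq hξ hL hN _ fun _ => 0, Fin.prod_univ_succ]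
    simp only [Fin.val_zero, Fin.val_succ, pre_cons]
    congr 2
  · refine Finset.sum_eq_zero fun v _ => ?_
    change P.real (E (Fin.cons y v : Fin (m + 1) → ZMod p)) = _
    simp only [hE, Fin.cons_zero, if_neg hy, measureReal_empty]

end Expectation

/-! ### Contraction for the law of `ξ`. -/

/-- Two distinct unit vectors with positive weights are not on a common ray, so the triangle
inequality is strict for that pair. -/
lemma norm_combination_lt_one {ι : Type*} [Fintype ι] {w : ι → ℝ} {z : ι → ℂ}
    (hw : ∀ i, 0 ≤ w i) (hw1 : ∑ i, w i = 1) (hz : ∀ i, ‖z i‖ = 1) {a b : ι} (ha : 0 < w a)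
    (hb : 0 < w b) (hab : z a ≠ z b) : ‖∑ i, (w i : ℂ) * z i‖ < 1 := by
  have hne : a ≠ b := fun h => hab (by rw [h])
  have hnorm : ∀ i, ‖(w i : ℂ) * z i‖ = w i := fun i => by
    rw [norm_mul, hz, mul_one, Complex.norm_real, Real.norm_of_nonneg (hw i)]
  have hlt : ‖(w a : ℂ) * z a + (w b : ℂ) * z b‖ < w a + w b := by
    have hray : ¬ SameRay ℝ ((w a : ℂ) * z a) ((w b : ℂ) * z b) := by
      intro h
      refine hab ?_
      have h1 := h.norm_smul_eq
      rw [hnorm, hnorm, Complex.real_smul, Complex.real_smul] at h1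
      have ha' : (w a : ℂ) ≠ 0 := by exact_mod_cast ha.ne'
      have hb' : (w b : ℂ) ≠ 0 := by exact_mod_cast hb.ne'
      have h2 : (w a * w b : ℂ) * z b = (w a * w b : ℂ) * z a := by linear_combination h1
      exact (mul_left_cancel₀ (mul_ne_zero ha' hb') h2).symm
    have h := norm_add_lt_of_not_sameRay hray
    rwa [hnorm, hnorm] at h
  have hb_mem : b ∈ Finset.univ.erase a := Finset.mem_erase.2 ⟨hne.symm, Finset.mem_univ b⟩
  rw [← hw1, ← Finset.add_sum_erase _ _ (Finset.mem_univ a), ← Finset.add_sum_erase _ _ hb_mem,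
    ← Finset.add_sum_erase _ w (Finset.mem_univ a), ← Finset.add_sum_erase _ w hb_mem, ← add_assoc,
    ← add_assoc]
  refine (norm_add_le _ _).trans_lt (add_lt_add_of_lt_of_le hlt ?_)
  exact (norm_sum_le _ _).trans (Finset.sum_le_sum fun i _ => (hnorm i).le)

/-- If `ψ` agreed on both multiples of `x`, it would be trivial on `(coeff a - coeff b) • x`. That
difference is prime to `p`, hence invertible modulo `p ^ k`, so `ψ x = 1`. -/
lemma CoeffLaw.exists_contracts {ι : Type} [Fintype ι] (μ : CoeffLaw ι) {G : Type*}
    [AddCommGroup G] [Fintype G] {p k : ℕ} [Fact p.Prime] (hG : ∀ x : G, p ^ k • x = 0) {a b : ι}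
    (ha : 0 < μ.weight a) (hb : 0 < μ.weight b) (hpa : (p : ℤ) ∣ μ.coeff a)
    (hpb : ¬ (p : ℤ) ∣ μ.coeff b) : ∃ θ, μ.Contracts G θ := by
  have hlt : ∀ (ψ : AddChar G ℂ) (x : G), ψ x ≠ 1 → ‖μ.charMean ψ x‖ < 1 := by
    intro ψ x hx
    refine norm_combination_lt_one μ.weight_nonneg μ.sum_weight
      (fun i => AddChar.norm_apply ψ _) ha hb fun h => hx ?_
    have hd : (μ.coeff a - μ.coeff b) • x ∈ CoeffLaw.kerChar ψ := by
      rw [CoeffLaw.mem_kerChar, sub_zsmul, ← sub_eq_add_neg, AddChar.map_sub_eq_div, h, div_self]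
      intro h0
      have := AddChar.norm_apply ψ (μ.coeff b • x)
      rw [h0, norm_zero] at this
      exact zero_ne_one this
    have hcop : IsCoprime (μ.coeff a - μ.coeff b) ((p : ℤ) ^ k) := by
      refine IsCoprime.pow_right (((Nat.prime_iff_prime_int.1 (Fact.out : p.Prime)).coprime_iff_not_dvd.2
        fun h => hpb ?_).symm)
      simpa using dvd_sub hpa h
    obtain ⟨s, t, hst⟩ := hcop
    have hx' : x = s • ((μ.coeff a - μ.coeff b) • x) := by
      have h1 : ((p : ℤ) ^ k) • x = 0 := by
        rw [← hG x, ← natCast_zsmul]; push_cast; rfl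
      conv_lhs => rw [← one_zsmul x, ← hst, add_zsmul, mul_zsmul, mul_zsmul, h1, smul_zero,
        add_zero]
    have := (CoeffLaw.kerChar ψ).zsmul_mem hd s
    rwa [← hx'] at this
  -- A maximum over finitely many pairs; the floor `1/2` keeps `θ` positive even when all relevant
  -- means vanish.
  obtain ⟨e, he⟩ := Finite.exists_max fun e : AddChar G ℂ × G =>
    if e.1 e.2 = 1 then (1 / 2 : ℝ) else max (1 / 2) ‖μ.charMean e.1 e.2‖
  refine ⟨if e.1 e.2 = 1 then (1 / 2 : ℝ) else max (1 / 2) ‖μ.charMean e.1 e.2‖, ?_, ?_, ?_⟩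
  · split_ifs
    · norm_num
    · exact lt_max_of_lt_left (by norm_num)
  · split_ifs with h
    · norm_num
    · exact max_lt (by norm_num) (hlt _ _ h)
  · intro ψ x hx
    have := he (ψ, x)
    simp only [if_neg hx] at this
    exact (le_max_right _ _).trans this

section ModLaw

variable {p : ℕ} [Fact p.Prime] {Ω₀ : Type*} [MeasurableSpace Ω₀] {P₀ : Measure Ω₀}
  [IsProbabilityMeasure P₀] {ξ : Ω₀ → ℤ} (hξ : Measurable ξ)

lemma exists_weight_modLaw_pos (N : ℕ) [NeZero N] {T : Set ℤ} (hT : P₀ {ω | ξ ω ∈ T} ≠ 0) :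
    ∃ z ∈ T, 0 < (modLaw P₀ hξ N).weight (z : ZMod N) := by
  by_contra! h
  refine hT (measure_mono_null (t := ⋃ z ∈ T, (fun ω => (ξ ω : ZMod N)) ⁻¹' {(z : ZMod N)})
    (fun ω hω => Set.mem_biUnion (x := ξ ω) hω rfl) ?_)
  refine (measure_biUnion_null_iff T.to_countable).2 fun z hz => ?_
  have h1 : P₀.real ((fun ω => (ξ ω : ZMod N)) ⁻¹' {(z : ZMod N)}) ≤ 0 := h z hz
  exact (measureReal_eq_zero_iff).1 (le_antisymm h1 measureReal_nonneg)

omit [Fact p.Prime] in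
lemma dvd_coeff_modLaw_iff {k : ℕ} [NeZero (p ^ (k + 1))] (z : ℤ) :
    (p : ℤ) ∣ (modLaw P₀ hξ (p ^ (k + 1))).coeff (z : ZMod (p ^ (k + 1))) ↔ (p : ℤ) ∣ z := by
  change (p : ℤ) ∣ (((z : ZMod (p ^ (k + 1))).val : ℕ) : ℤ) ↔ _
  rw [ZMod.val_intCast]
  exact EuclideanDomain.dvd_mod_iff (by exact_mod_cast dvd_pow_self p k.succ_ne_zero)

include hξ in
lemma exists_contracts_modLaw (hpos : 0 < P₀ {ω | (p : ℤ) ∣ ξ ω})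
    (hlt : P₀ {ω | (p : ℤ) ∣ ξ ω} < 1) {k : ℕ} [NeZero (p ^ (k + 1))] {G : Type*} [AddCommGroup G]
    [Fintype G] (hG : ∀ x : G, p ^ (k + 1) • x = 0) :
    ∃ θ, (modLaw P₀ hξ (p ^ (k + 1))).Contracts G θ := by
  have hcompl : P₀ {ω | ξ ω ∈ {z : ℤ | ¬ (p : ℤ) ∣ z}} ≠ 0 := by
    intro h
    have hm : MeasurableSet {ω | (p : ℤ) ∣ ξ ω} :=
      hξ (MeasurableSet.of_discrete (s := {z : ℤ | (p : ℤ) ∣ z}))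
    exact hlt.ne ((prob_compl_eq_zero_iff hm).1 h)
  obtain ⟨z, hz, hwz⟩ := exists_weight_modLaw_pos hξ (p ^ (k + 1))
    (T := {z : ℤ | (p : ℤ) ∣ z}) hpos.ne'
  obtain ⟨z', hz', hwz'⟩ := exists_weight_modLaw_pos hξ (p ^ (k + 1))
    (T := {z : ℤ | ¬ (p : ℤ) ∣ z}) hcompl
  exact CoeffLaw.exists_contracts _ hG hwz hwz' ((dvd_coeff_modLaw_iff hξ z).2 hz)
    (mt (dvd_coeff_modLaw_iff hξ z').1 hz')

end ModLaw

end TriangularKernel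

open TriangularKernel in
theorem theorem2p3 (p : ℕ) [Fact p.Prime]
    {Ω₀ : Type*} [MeasurableSpace Ω₀] (P₀ : Measure Ω₀) [IsProbabilityMeasure P₀]
    (ξ : Ω₀ → ℤ) (hξ : Measurable ξ)
    (hξ_pos : 0 < P₀ {ω | (p : ℤ) ∣ ξ ω}) (hξ_lt_one : P₀ {ω | (p : ℤ) ∣ ξ ω} < 1)
    {Ω : ℕ → Type*} [∀ n, MeasurableSpace (Ω n)] (P : ∀ n, Measure (Ω n))
    [∀ n, IsProbabilityMeasure (P n)]
    (L : ∀ n, Ω n → Matrix (Fin n) (Fin n) ℤ)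
    (hL : ∀ n, IsIIDLowerTriangular P₀ ξ (P n) (L n)) :
    ∃ χ₀ : ℝ, 0 < χ₀ ∧
      Tendsto (fun n => expectedKernelCardFirstNeZero p (P n) (L n)) atTop (𝓝 χ₀) ∧
      ∀ (G : Type*) [AddCommGroup G] [Finite G] (ℓ : ℕ), Nat.card G = p ^ ℓ →
        Tendsto (fun n : ℕ => ((n : ℝ) ^ ℓ)⁻¹ * expectedKernelCard (P n) (L n) G) atTop
          (𝓝 (χ₀ ^ ℓ * (maximalChainCount G ℓ : ℝ) / (ℓ.factorial : ℝ))) := by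
  have hp : p.Prime := Fact.out
  have hne : ∀ k, NeZero (p ^ k) := fun k => ⟨pow_ne_zero k hp.ne_zero⟩
  have hZ : ∀ k, ∀ x : ZMod p, p ^ (k + 1) • x = 0 := fun k x => by
    rw [pow_succ, mul_smul]; simp
  have hfirst : ∀ k m, expectedKernelCardFirstNeZero p (P (m + 1)) (L (m + 1)) =
      (modLaw P₀ hξ (p ^ (k + 1))).firstNeZeroWeight p m := fun k m =>
    expectedKernelCardFirstNeZero_eq hξ (hL (m + 1)) (hZ k)
  obtain ⟨θ, hθ⟩ := exists_contracts_modLaw hξ hξ_pos hξ_lt_one (hZ 0)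
  have hmix := hθ.mixes (translateBound_modLaw hξ hL (hZ 0)) ⊤
  obtain ⟨χ, hχ⟩ := CoeffLaw.Contracts.exists_tendsto_firstNeZeroWeight hmix
  obtain ⟨z, hz, hwz⟩ := exists_weight_modLaw_pos hξ (p ^ (0 + 1))
    (T := {z : ℤ | (p : ℤ) ∣ z}) hξ_pos.ne'
  have hlim : Tendsto (fun n => expectedKernelCardFirstNeZero p (P n) (L n)) atTop (𝓝 χ) := by
    rw [← tendsto_add_atTop_iff_nat 1]
    exact hχ.congr fun m => (hfirst 0 m).symm
  refine ⟨χ, hθ.limit_pos hwz ((dvd_coeff_modLaw_iff hξ z).2 hz) hχ, hlim, ?_⟩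
  intro G _ _ ℓ hG
  have := Fintype.ofFinite G
  -- The exponent `ℓ + 1` instead of `ℓ` ensures that residues still detect divisibility by `p` when
  -- `ℓ = 0`.
  have hGN : ∀ x : G, p ^ (ℓ + 1) • x = 0 := fun x => by
    rw [pow_succ', mul_smul, ← hG, card_nsmul_eq_zero', smul_zero]
  obtain ⟨θ', hθ'⟩ := exists_contracts_modLaw hξ hξ_pos hξ_lt_one hGN
  -- The reduced law depends on the modulus, but its `ZMod p` weights equal the same expectations
  -- for `L`, so the same `χ` serves for every `G`.
  have hχ' : Tendsto ((modLaw P₀ hξ (p ^ (ℓ + 1))).firstNeZeroWeight p) atTop (𝓝 χ) :=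
    ((tendsto_add_atTop_iff_nat 1).2 hlim).congr fun m => hfirst ℓ m
  refine (hθ'.tendsto_step_top_pow (translateBound_modLaw hξ hL hGN) hG hχ').congr fun n => ?_
  rw [expectedKernelCard_eq hξ (hL n) hGN, div_eq_inv_mul]
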